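/- **Setting.** Let $k$ be a field and $A=kQ/I$ a gentle algebra ($Q$ a finite quiver; paths are multiplied from left to right; modules are right modules). Let $\mathcal S=(\mathcal S,\mathcal M,\Gamma)$ be its marked ribbon surface: a connected oriented surface obtained from finitely many *elementary polygons* by gluing their sides in $\Gamma$ (the *arcs*) in pairs, compatibly with the orientation. Each elementary polygon has at least one side in $\Gamma$ and exactly one side not in $\Gamma$, which is either a segment of $\partial\mathcal S$ between two marked points, or a whole boundary component without marked points in the interior of the polygon (the polygon is then an annulus with all its outer sides in $\Gamma$). The ends of the arcs are the *marked points* $\mathcal M$; all of them lie on $\partial\mathcal S$. A disc polygon with only one side in $\Gamma$ has in addition one *extra point* on its boundary segment. The bound quiver $(Q,I)$ is identified with that of $\mathcal S$: vertices are the arcs; each corner between two consecutive sides $u,v\in\Gamma$ of a polygon gives an arrow $u\to v$ if $v$ follows $u$ counterclockwise around the common vertex; $I$ is generated by the compositions of the arrows of consecutive corners of one polygon. The positive direction of $\partial\mathcal S$, and of the boundary of each elementary polygon, is the one with the interior on the left. **Curves.** Curves have endpoints among the marked and extra points, interior in $\mathcal S\setminus\partial\mathcal S$, and a number of crossings with $\Gamma$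 that is minimal up to homotopy with fixed endpoints. Such a curve is written $c=c_1c_2\cdots c_r$, where $c$ consecutively crosses the arcs $\gamma_1,\dots,\gamma_{r-1}$ and each segment $c_j$ lies in one elementary polygon. It is *permissible* if its end segments wind at most once around an unmarked boundary component, and each middle segment $c_{j+1}$ ($1\le j\le r-2$) joins consecutive sides $\gamma_j,\gamma_{j+1}$ of its polygon and cuts off a triangle at their common vertex $p(\gamma_j,\gamma_{j+1},c)$. *Equivalence* $\simeq$ of permissible curves is the equivalence relation generated by: reversal; homotopy; moving an endpoint along sides in $\Gamma$ of the polygon containing the end segment while keeping the crossing of that end segment; and identifying all curves that cross no arc (*trivial* curves). For a nontrivial $c$, let $M(c)$ be the string module of the string $\gamma_1 - \cdots - \gamma_{r-1}$ whose $j$-th letter is the arrow $\gamma_j\to\gamma_{j+1}$ of the corner cut off by $c_{j+1}$ if $p(\gamma_j,\gamma_{j+1},c)$ is on the left of $c$ (that is, $c$ turns counterclockwise around it), and the formal inverse of the arrow $\gamma_{j+1}\to\gamma_j$ if it is on the right. If $c$ is trivial, $M(c)=0$. Put $M(x\oplus y)=M(x)\oplus M(y)$. **Truncations.** For $1\le m\le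 n\le r-1$ let $c_{[m,n]}=c_m^{\mathfrak T}c_{m+1}\cdots c_n c_{n+1}^{\mathfrak T}$ be the permissible curve crossing $\gamma_m,\dots,\gamma_n$ as $c$ does, where $c_m^{\mathfrak T}$ (for $m>1$) starts, inside the polygon of $c_m$, at the end of $\gamma_{m-1}$ other than the vertex $p(\gamma_{m-1},\gamma_m,c)$; $c_{n+1}^{\mathfrak T}$ (for $n<r-1$) ends, inside the polygon of $c_{n+1}$, at the end of $\gamma_{n+1}$ other than the vertex $p(\gamma_n,\gamma_{n+1},c)$; and $c_1^{\mathfrak T}=c_1$, $c_r^{\mathfrak T}=c_r$. **Theorem.** Let all curves below be permissible, and $c=c_1\cdots c_r$ as above. 1. (Case I) Let $1\le i\le r-2$, $\gamma'=\gamma_i$, $\gamma''=\gamma_{i+1}$, and suppose that $p(\gamma',\gamma'',c)$ is on the right of $c$. Let $c'\simeq c_{[1,i]}$ (so that, up to equivalence, $c'$ starts with $c$, crosses $\gamma'$ and ends at the other end of $\gamma''$), and let $c''$ be equivalent to the *positive rotation* of $c_{[1,i]}$ with respect to $c$, that is, to a permissible curve homotopic to the one obtained from $c_{[1,i]}$ by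 moving its starting point along $c$ to the endpoint of $c$, and moving its other endpoint in the positive direction along the boundary of the polygon containing $c_{i+1}$ to a vertex of that polygon for which the new curve enters this polygon for the last time through $\gamma''$. Then there is a short exact sequence of $A$-modules $$0\to M(c')\to M(c)\to M(c'')\to 0 .$$ 2. (Case II) Let $1\le m\le i\le n\le r-1$ be such that $p(\gamma_j,\gamma_{j+1},c)$ is on the left of $c$ for all $j$ with $\max(m-1,1)\le j<i$, and on the right of $c$ for all $j$ with $i\le j\le \min(n,r-2)$. Let $c'\simeq c_{[m,n]}$. The crossing of $c_{[m,n]}$ with $\gamma_i$, where it meets $c$, divides it into two parts. Let $c''_{\mathrm I}$ (respectively $c''_{\mathrm{II}}$) be equivalent to the *positive rotation* of the first (respectively second) part, that is, to a permissible curve homotopic to the one obtained from this part by moving its end at $\gamma_i$ along $c$ to the starting point (respectively endpoint) of $c$, and moving its other end, which is the starting point (respectively endpoint) of $c_{[m,n]}$, to the next vertex in the positive direction of the polygon containing $c_m$ (respectively $c_{n+1}$), an extra point counting as a vertex. Then there is a short exact sequence of $A$-modules $$0\to M(c')\to M(c)\to M(c''_{\mathrm I}\oplus c''_{\mathrm{II}})\to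 0 .$$ 3. (Case III) Dually, let $1\le m\le i\le n\le r-1$ be such that $p(\gamma_j,\gamma_{j+1},c)$ is on the right of $c$ for $\max(m-1,1)\le j<i$ and on the left of $c$ for $i\le j\le\min(n,r-2)$, let $c''\simeq c_{[m,n]}$, and let $c'_{\mathrm I}$, $c'_{\mathrm{II}}$ be equivalent to the *negative rotations* (defined in the same way with the negative direction) of its two parts. Then there is a short exact sequence of $A$-modules $$0\to M(c'_{\mathrm I}\oplus c'_{\mathrm{II}})\to M(c)\to M(c'')\to 0 .$$ -/

import Mathlib

/-! ## Bound quivers with quadratic monomial relations, gentle algebras -/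

/-- A quiver with vertex set `V` and arrow set `E`, together with a set of paths `αβ` of length two
(`rel α β`: first `α`, then `β`), which are the generators of the ideal `I`. -/
structure BoundQuiver (V : Type*) (E : Type*) where
  s : E → V
  t : E → V
  rel : E → E → Prop
  rel_comp : ∀ {α β}, rel α β → t α = s β

namespace BoundQuiver

variable {V V' : Type*} {E E' : Type*}

/-- `β` can follow `α` in a path that contains no relation. -/
def Follows (Q : BoundQuiver V E) (α β : E) : Prop := Q.t α = Q.s β ∧ ¬ Q.rel α β

/-- `kQ/I` is gentle (for a finite quiver `Q`). As `I` is generated by paths of length two, a path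
lies in `I` iff two of its consecutive arrows form a relation. -/
structure IsGentle (Q : BoundQuiver V E) : Prop where
  out_le : ∀ v, {α | Q.s α = v}.encard ≤ 2
  in_le : ∀ v, {α | Q.t α = v}.encard ≤ 2
  prev_le : ∀ β, {α | Q.t α = Q.s β ∧ ¬ Q.rel α β}.encard ≤ 1
  next_le : ∀ β, {α | Q.t β = Q.s α ∧ ¬ Q.rel β α}.encard ≤ 1
  bound_prev : ∀ β, ∃ n : ℕ, ∀ l : List E, l.length = n → ¬ (l ++ [β]).IsChain Q.Follows
  bound_next : ∀ β, ∃ n : ℕ, ∀ l : List E, l.length = n → ¬ (β :: l).IsChain Q.Follows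
  admissible : ∃ n : ℕ, ∀ l : List E, l.length = n → ¬ l.IsChain Q.Follows
  prev_rel_le : ∀ β, {α | Q.rel α β}.encard ≤ 1
  next_rel_le : ∀ β, {α | Q.rel β α}.encard ≤ 1

/-- Isomorphisms of bound quivers. -/
structure Iso (Q : BoundQuiver V E) (Q' : BoundQuiver V' E') where
  vert : V ≃ V'
  arr : E ≃ E'
  map_s : ∀ α, Q'.s (arr α) = vert (Q.s α)
  map_t : ∀ α, Q'.t (arr α) = vert (Q.t α)
  map_rel : ∀ α β, Q'.rel (arr α) (arr β) ↔ Q.rel α β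

/-- Defining relations of `kQ/I` on the generators `e_v` (`v ∈ V`) and `α ∈ E`; products of arrows
are concatenations from left to right. -/
inductive AlgRel (k : Type*) [CommSemiring k] [Fintype V] (Q : BoundQuiver V E) :
    FreeAlgebra k (V ⊕ E) → FreeAlgebra k (V ⊕ E) → Prop
  | idem (v : V) : AlgRel k Q (.ι k (.inl v) * .ι k (.inl v)) (.ι k (.inl v))
  | orth (v w : V) : v ≠ w → AlgRel k Q (.ι k (.inl v) * .ι k (.inl w)) 0
  | one : AlgRel k Q (∑ v, .ι k (.inl v)) 1
  | source (α : E) : AlgRel k Q (.ι k (.inl (Q.s α)) * .ι k (.inr α)) (.ι k (.inr α))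
  | target (α : E) : AlgRel k Q (.ι k (.inr α) * .ι k (.inl (Q.t α))) (.ι k (.inr α))
  | zero (α β : E) : Q.rel α β → AlgRel k Q (.ι k (.inr α) * .ι k (.inr β)) 0

/-- The algebra `A = kQ/I`: the path algebra of `Q` modulo the ideal generated by the relations. -/
abbrev Algebra (k : Type*) [CommRing k] [Fintype V] (Q : BoundQuiver V E) : Type _ :=
  RingQuot (AlgRel k Q)

/-! ### Strings and string modules -/

/-- Source of a letter: `(α, true)` is the arrow `α`, `(α, false)` its formal inverse. -/
def src (Q : BoundQuiver V E) (a : E × Bool) : V := if a.2 then Q.s a.1 else Q.t a.1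

/-- Target of a letter. -/
def tgt (Q : BoundQuiver V E) (a : E × Bool) : V := if a.2 then Q.t a.1 else Q.s a.1

/-- The letters `a, b` may be consecutive in a string: they compose, they are not inverse to each
other, and neither `ab` nor its inverse is a relation. -/
def Consec (Q : BoundQuiver V E) (a b : E × Bool) : Prop :=
  Q.tgt a = Q.src b ∧ ¬ (a.1 = b.1 ∧ a.2 ≠ b.2) ∧
    (a.2 = true → b.2 = true → ¬ Q.rel a.1 b.1) ∧
    (a.2 = false → b.2 = false → ¬ Q.rel b.1 a.1)

/-- A nonzero string: a starting vertex and a (possibly empty) list of letters. -/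
structure Str (Q : BoundQuiver V E) where
  start : V
  letters : List (E × Bool)
  src_head : ∀ a ∈ letters.head?, Q.src a = start
  chain : letters.IsChain Q.Consec

/-- Number of vertices of a string; `none` is the trivial string `0`. -/
def size {Q : BoundQuiver V E} : Option Q.Str → ℕ
  | none => 0
  | some w => w.letters.length + 1

/-- The vertex at the position `p` of a string lies over `v`. -/
def AtVertex {Q : BoundQuiver V E} : Option Q.Str → ℕ → V → Prop
  | none, _, _ => False
  | some w, 0, v => w.start = v
  | some w, p + 1, v => ∃ a, w.letters[p]? = some a ∧ Q.tgt a = v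

/-- The arrow `α` of the string leads from the position `p` to the neighbouring position `q`. -/
def Leads {Q : BoundQuiver V E} (α : E) : Option Q.Str → ℕ → ℕ → Prop
  | none, _, _ => False
  | some w, p, q => (q = p + 1 ∧ w.letters[p]? = some (α, true)) ∨
      (p = q + 1 ∧ w.letters[q]? = some (α, false))

theorem atVertex_unique {Q : BoundQuiver V E} {s : Option Q.Str} {p : ℕ} {v w : V}
    (hv : AtVertex s p v) (hw : AtVertex s p w) : v = w := by
  cases s with
  | none => exact hv.elim
  | some u =>
    cases p with
    | zero => exact hv.symm.trans hw
    | succ p =>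
      obtain ⟨a, ha, rfl⟩ := hv
      obtain ⟨b, hb, rfl⟩ := hw
      rw [ha] at hb
      rw [Option.some.inj hb]

theorem atVertex_exists {Q : BoundQuiver V E} {s : Option Q.Str} {p : ℕ} (hp : p < size s) :
    ∃ v, AtVertex s p v := by
  cases s with
  | none => exact absurd hp (Nat.not_lt_zero _)
  | some u =>
    cases p with
    | zero => exact ⟨_, rfl⟩
    | succ p =>
      have h : p < u.letters.length := Nat.lt_of_succ_lt_succ hp
      exact ⟨_, u.letters[p], by simp [h], rfl⟩

theorem atVertex_src {Q : BoundQuiver V E} {u : Q.Str} {p : ℕ} {a : E × Bool}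
    (h : u.letters[p]? = some a) : AtVertex (some u) p (Q.src a) := by
  cases p with
  | zero =>
    refine (u.src_head a ?_).symm
    rw [List.head?_eq_getElem?]; exact h
  | succ p =>
    obtain ⟨hp, rfl⟩ := List.getElem?_eq_some_iff.1 h
    have := List.isChain_iff_getElem.1 u.chain p hp
    exact ⟨u.letters[p], by simp, this.1⟩

theorem Leads.source {Q : BoundQuiver V E} {s : Option Q.Str} {α : E} {p q : ℕ}
    (h : Leads α s p q) : AtVertex s p (Q.s α) := by
  cases s with
  | none => exact h.elim
  | some u =>
    rcases h with ⟨rfl, h⟩ | ⟨rfl, h⟩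
    · exact atVertex_src h
    · exact ⟨_, h, rfl⟩

theorem Leads.target {Q : BoundQuiver V E} {s : Option Q.Str} {α : E} {p q : ℕ}
    (h : Leads α s p q) : AtVertex s q (Q.t α) := by
  cases s with
  | none => exact h.elim
  | some u =>
    rcases h with ⟨rfl, h⟩ | ⟨rfl, h⟩
    · exact ⟨_, h, rfl⟩
    · exact atVertex_src h

theorem Leads.no_rel {Q : BoundQuiver V E} {s : Option Q.Str} {α β : E} {p q r : ℕ}
    (h : Leads α s p q) (h' : Leads β s q r) : ¬ Q.rel α β := by
  cases s with
  | none => exact h.elim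
  | some u =>
    rcases h with ⟨rfl, h⟩ | ⟨rfl, h⟩ <;> rcases h' with ⟨rfl, h'⟩ | ⟨hr, h'⟩
    · obtain ⟨hp, e⟩ := List.getElem?_eq_some_iff.1 h'
      obtain ⟨hp', e'⟩ := List.getElem?_eq_some_iff.1 h
      have := List.isChain_iff_getElem.1 u.chain p hp
      rw [e, e'] at this
      exact this.2.2.1 rfl rfl
    · obtain rfl : p = r := by omega
      rw [h] at h'
      simp at h'
    · rw [h] at h'
      simp at h'
    · subst hr
      obtain ⟨hp, e⟩ := List.getElem?_eq_some_iff.1 h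
      obtain ⟨hp', e'⟩ := List.getElem?_eq_some_iff.1 h'
      have := List.isChain_iff_getElem.1 u.chain r hp
      rw [e, e'] at this
      exact this.2.2.2 rfl rfl

open Classical in
/-- Matrices (acting on row vectors) of the generators of `A` on the string module. -/
noncomputable def genMatrix (k : Type*) [CommRing k] {Q : BoundQuiver V E} (s : Option Q.Str) :
    V ⊕ E → Matrix (Fin (size s)) (Fin (size s)) k
  | .inl v => fun p q => if p = q ∧ AtVertex s p v then 1 else 0
  | .inr α => fun p q => if Leads α s p q then 1 else 0

theorem genMatrix_rel (k : Type*) [CommRing k] [Fintype V] {Q : BoundQuiver V E}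
    (s : Option Q.Str) ⦃x y : FreeAlgebra k (V ⊕ E)⦄ (h : AlgRel k Q x y) :
    FreeAlgebra.lift k (genMatrix k s) x = FreeAlgebra.lift k (genMatrix k s) y := by
  classical
  cases h with
  | idem v =>
    simp only [map_mul, FreeAlgebra.lift_ι_apply]
    ext p q
    rw [Matrix.mul_apply, Finset.sum_eq_single p]
    · by_cases hp : AtVertex s p v <;> simp [genMatrix, hp]
    · intro b _ hb; simp [genMatrix, hb.symm]
    · simp
  | orth v w hvw =>
    simp only [map_mul, FreeAlgebra.lift_ι_apply, map_zero]
    ext p q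
    rw [Matrix.mul_apply]
    refine Finset.sum_eq_zero fun b _ => ?_
    by_cases h1 : p = b ∧ AtVertex s p v
    · obtain ⟨rfl, h1⟩ := h1
      have : ¬ AtVertex s p w := fun h2 => hvw (atVertex_unique h1 h2)
      simp [genMatrix, this]
    · simp [genMatrix, h1]
  | one =>
    simp only [map_sum, FreeAlgebra.lift_ι_apply, map_one]
    ext p q
    rw [Matrix.sum_apply]
    obtain ⟨v, hv⟩ := atVertex_exists p.2
    rw [Finset.sum_eq_single v]
    · simp [genMatrix, hv, Matrix.one_apply]
    · intro w _ hw
      have : ¬ AtVertex s p w := fun h2 => hw (atVertex_unique h2 hv)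
      simp [genMatrix, this]
    · simp
  | source α =>
    simp only [map_mul, FreeAlgebra.lift_ι_apply]
    ext p q
    rw [Matrix.mul_apply, Finset.sum_eq_single p]
    · by_cases hp : Leads α s p q
      · simp [genMatrix, hp, hp.source]
      · simp [genMatrix, hp]
    · intro b _ hb; simp [genMatrix, hb.symm]
    · simp
  | target α =>
    simp only [map_mul, FreeAlgebra.lift_ι_apply]
    ext p q
    rw [Matrix.mul_apply, Finset.sum_eq_single q]
    · by_cases hp : Leads α s p q
      · simp [genMatrix, hp, hp.target]
      · simp [genMatrix, hp]
    · intro b _ hb; simp [genMatrix, hb]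
    · simp
  | zero α β hr =>
    simp only [map_mul, FreeAlgebra.lift_ι_apply, map_zero]
    ext p q
    rw [Matrix.mul_apply]
    refine Finset.sum_eq_zero fun b _ => ?_
    by_cases h1 : Leads α s p b
    · have : ¬ Leads β s b q := fun h2 => h1.no_rel h2 hr
      simp [genMatrix, this]
    · simp [genMatrix, h1]

/-- The matrix representation of `A` on the string module. -/
noncomputable def stringRep (k : Type*) [CommRing k] [Fintype V] {Q : BoundQuiver V E}
    (s : Option Q.Str) : Q.Algebra k →ₐ[k] Matrix (Fin (size s)) (Fin (size s)) k :=
  RingQuot.liftAlgHom k ⟨FreeAlgebra.lift k (genMatrix k s), genMatrix_rel k s⟩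

/-- The string module `M(s)`: one copy of `k` for every vertex of the string. -/
def StringModule (k : Type*) [CommRing k] {Q : BoundQuiver V E} (s : Option Q.Str) : Type _ :=
  Fin (size s) → k

instance (k : Type*) [CommRing k] {Q : BoundQuiver V E} (s : Option Q.Str) :
    AddCommGroup (StringModule k s) :=
  inferInstanceAs (AddCommGroup (Fin (size s) → k))

/-- `M(s)` is a right `A`-module, that is, a module over `Aᵐᵒᵖ`. -/
noncomputable instance (k : Type*) [CommRing k] [Fintype V] {Q : BoundQuiver V E}
    (s : Option Q.Str) : Module (Q.Algebra k)ᵐᵒᵖ (StringModule k s) where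
  smul a x := Matrix.vecMul x (stringRep k s a.unop)
  one_smul x := by
    change Matrix.vecMul x (stringRep k s 1) = x
    rw [map_one]; exact Matrix.vecMul_one x
  mul_smul a b x := by
    change Matrix.vecMul x (stringRep k s (b.unop * a.unop)) =
      Matrix.vecMul (Matrix.vecMul x (stringRep k s b.unop)) (stringRep k s a.unop)
    rw [map_mul]; exact (Matrix.vecMul_vecMul x _ _).symm
  smul_zero a := Matrix.zero_vecMul _
  smul_add a x y := Matrix.add_vecMul _ x y
  add_smul a b x := by
    change Matrix.vecMul x (stringRep k s (a.unop + b.unop)) = _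
    rw [map_add]; exact Matrix.vecMul_add _ _ x
  zero_smul x := by
    change Matrix.vecMul x (stringRep k s 0) = 0
    rw [map_zero]; exact Matrix.vecMul_zero x

/-- Transport of strings along an isomorphism of bound quivers. -/
def Iso.mapStr {Q : BoundQuiver V E} {Q' : BoundQuiver V' E'} (φ : Q.Iso Q') (w : Q.Str) :
    Q'.Str where
  start := φ.vert w.start
  letters := w.letters.map fun a => (φ.arr a.1, a.2)
  src_head := by
    intro a ha
    rw [List.head?_map] at ha
    obtain ⟨b, hb, rfl⟩ := Option.mem_map.1 ha
    rw [← w.src_head b hb]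
    rcases b with ⟨b, _ | _⟩ <;> simp [src, φ.map_s, φ.map_t]
  chain := by
    rw [List.isChain_map]
    refine w.chain.imp ?_
    rintro ⟨a, x⟩ ⟨b, y⟩ ⟨h1, h2, h3, h4⟩
    refine ⟨?_, ?_, ?_, ?_⟩
    · cases x <;> cases y <;> simpa [tgt, src, φ.map_s, φ.map_t] using h1
    · simpa using h2
    · simpa [φ.map_rel] using h3
    · simpa [φ.map_rel] using h4

end BoundQuiver

/-! ## Marked ribbon surfaces -/

/-- A marked ribbon surface `(𝒮, ℳ, Γ)`, given by its dissection into elementary polygons: the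
oriented surface is obtained from finitely many oriented polygons by gluing their sides in `Γ` in
pairs, reversing the orientations of the sides.

Each polygon `Δ` has exactly one side that is not in `Γ`. If `holed Δ = false`, then `Δ` is a disc
whose boundary consists, in the clockwise order, of the sides `0, …, n Δ - 1` in `Γ` and of one
segment of the boundary of `𝒮`. If `holed Δ = true`, then `Δ` is an annulus; its outer boundary
consists, in the clockwise order, of the sides `0, …, n Δ - 1`, all in `Γ`, and its inner boundary
is a boundary component of `𝒮` without marked points. -/
structure MarkedRibbonSurface where
  Poly : Type*
  finite_poly : Finite Poly
  nonempty_poly : Nonempty Poly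
  n : Poly → ℕ
  n_pos : ∀ Δ, 0 < n Δ
  holed : Poly → Bool
  /-- the other copy, in the polygons, of the same arc -/
  glue : (Σ Δ, Fin (n Δ)) → (Σ Δ, Fin (n Δ))
  glue_glue : ∀ h, glue (glue h) = h
  glue_ne : ∀ h, glue h ≠ h
  connected : ∀ Δ Δ', Relation.ReflTransGen (fun D D' => ∃ i j, glue ⟨D, i⟩ = ⟨D', j⟩) Δ Δ'
  /-- Every marked point lies on the boundary of `𝒮`. Turning counterclockwise around the terminal
  vertex of a side `h`, the next side after `h` in the clockwise order of its polygon is crossed,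
  and so on; after finitely many steps the boundary of `𝒮` is reached. -/
  marked_boundary : ∀ h : (Σ Δ, Fin (n Δ)), ∃ m : ℕ,
    ∃ g, g = (fun h : (Σ Δ, Fin (n Δ)) =>
        glue ⟨h.1, ⟨(h.2.1 + 1) % n h.1, Nat.mod_lt _ (n_pos h.1)⟩⟩)^[m] h ∧
      holed g.1 = false ∧ g.2.1 + 1 = n g.1

namespace MarkedRibbonSurface

/-- The sides in `Γ` of the elementary polygons. -/
abbrev Side (S : MarkedRibbonSurface) : Type _ := Σ Δ, Fin (S.n Δ)

/-- The side with coordinate `i`. For an annulus, all integers are allowed, as coordinates in the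
universal cover, and `i`, `i + n Δ` give the same side. -/
def sideAt (S : MarkedRibbonSurface) (Δ : S.Poly) (i : ℤ) : S.Side :=
  ⟨Δ, ⟨(i % (S.n Δ : ℤ)).toNat, by
    have h0 : (0 : ℤ) < S.n Δ := by exact_mod_cast S.n_pos Δ
    have h1 := Int.emod_nonneg i h0.ne'
    have h2 := Int.emod_lt_of_pos i h0
    omega⟩⟩

/-- The side obtained from `g` by going `d` sides further in the clockwise order. -/
def shift (S : MarkedRibbonSurface) (g : S.Side) (d : ℤ) : S.Side := S.sideAt g.1 (g.2.1 + d)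

/-- In the clockwise order, `g` is followed by another side in `Γ` (with a common vertex). -/
def HasNext (S : MarkedRibbonSurface) (g : S.Side) : Prop :=
  S.holed g.1 = true ∨ g.2.1 + 1 < S.n g.1

/-- The set `Γ` of arcs. -/
def Arc (S : MarkedRibbonSurface) : Type _ := Quot fun g h : S.Side => S.glue g = h

/-- The arc that a side is a copy of. -/
def arc (S : MarkedRibbonSurface) (g : S.Side) : S.Arc := Quot.mk _ g

/-- The corners between two consecutive sides in `Γ`. In the clockwise order of the sides of the
polygon, the side after `g` is obtained from `g` by a counterclockwise turn around their common
vertex. -/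
abbrev Arrow (S : MarkedRibbonSurface) : Type _ := {g : S.Side // S.HasNext g}

/-- The bound quiver `(Q_𝒮, I_𝒮)`: the vertices are the arcs; each corner between consecutive sides
`u`, `v` in `Γ` of an elementary polygon gives an arrow `u → v` if `v` follows `u` in the
counterclockwise order around their common vertex; the relations are the compositions of arrows
`u → v`, `v → w` of consecutive corners of the same polygon. -/
def boundQuiver (S : MarkedRibbonSurface) : BoundQuiver S.Arc S.Arrow where
  s α := S.arc α.1
  t α := S.arc (S.shift α.1 1)
  rel α β := S.shift α.1 1 = β.1
  rel_comp h := congrArg S.arc h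

/-- The number of points of a polygon at which curves may end: the marked points on it, which are
the ends of its sides, and, for a disc with a single side in `Γ`, the extra point on its boundary
segment. -/
def numVert (S : MarkedRibbonSurface) (Δ : S.Poly) : ℕ :=
  if S.holed Δ = true then S.n Δ else if S.n Δ = 1 then 3 else S.n Δ + 1

/-- Vertices of polygons. They are numbered in the clockwise order such that the side `i` goes from
the vertex `i` to the vertex `i + 1` (modulo `n Δ` for an annulus). For a disc with a single side,
the vertex `2` is the extra point. -/
abbrev Vertex (S : MarkedRibbonSurface) : Type _ := Σ Δ, Fin (S.numVert Δ)

theorem numVert_pos (S : MarkedRibbonSurface) (Δ : S.Poly) : 0 < S.numVert Δ := by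
  have := S.n_pos Δ
  unfold numVert
  split_ifs <;> omega

/-- The vertex with coordinate `j`; for an annulus, all integers are allowed. -/
def vertexAt (S : MarkedRibbonSurface) (Δ : S.Poly) (j : ℤ) : S.Vertex :=
  ⟨Δ, ⟨(j % (S.numVert Δ : ℤ)).toNat, by
    have h0 : (0 : ℤ) < S.numVert Δ := by exact_mod_cast S.numVert_pos Δ
    have h1 := Int.emod_nonneg j h0.ne'
    have h2 := Int.emod_lt_of_pos j h0
    omega⟩⟩

/-- `i` is the coordinate of a side in `Γ` of `Δ`. -/
def IsSide (S : MarkedRibbonSurface) (Δ : S.Poly) (i : ℤ) : Prop :=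
  S.holed Δ = true ∨ (0 ≤ i ∧ i < S.n Δ)

/-- `j` is the coordinate of a vertex of `Δ`. -/
def IsVertex (S : MarkedRibbonSurface) (Δ : S.Poly) (j : ℤ) : Prop :=
  S.holed Δ = true ∨ (0 ≤ j ∧ j < S.numVert Δ)

/-! ### Curves -/

/-- `turns` describes a curve which starts in `Δ` at the side or vertex with coordinate `i`: if the
head of `turns` is `d` and not the last entry, then the curve leaves `Δ` through the side with
coordinate `i + d`; the last entry `e` means that it ends at the vertex with coordinate `i + e`. -/
def Valid (S : MarkedRibbonSurface) : (Δ : S.Poly) → ℤ → List ℤ → Prop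
  | _, _, [] => False
  | Δ, i, [e] => S.IsVertex Δ (i + e)
  | Δ, i, d :: d' :: l => S.IsSide Δ (i + d) ∧
      S.Valid (S.glue (S.sideAt Δ (i + d))).1 (S.glue (S.sideAt Δ (i + d))).2.1 (d' :: l)

/-- The sides through which the polygons are left, one for each crossing with `Γ`. -/
def exitsFrom (S : MarkedRibbonSurface) : (Δ : S.Poly) → ℤ → List ℤ → List S.Side
  | _, _, [] => []
  | _, _, [_] => []
  | Δ, i, d :: d' :: l => S.sideAt Δ (i + d) ::
      S.exitsFrom (S.glue (S.sideAt Δ (i + d))).1 (S.glue (S.sideAt Δ (i + d))).2.1 (d' :: l)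

/-- The vertex at which the curve ends. -/
def endFrom (S : MarkedRibbonSurface) : (Δ : S.Poly) → ℤ → List ℤ → S.Vertex
  | Δ, i, [] => S.vertexAt Δ i
  | Δ, i, [e] => S.vertexAt Δ (i + e)
  | Δ, i, d :: d' :: l =>
      S.endFrom (S.glue (S.sideAt Δ (i + d))).1 (S.glue (S.sideAt Δ (i + d))).2.1 (d' :: l)

/-- A curve `c = c₁c₂⋯c_r` in `𝒮` with endpoints in `ℳ ∪ E`, cut into its segments `c_j` by its
crossings with `Γ`, where each segment is taken up to homotopy in its elementary polygon. The entry
`turns[j]` gives the segment `c_{j+1}`: it is the difference of the coordinates of the ends of the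
segment, in the clockwise order of the sides or vertices of the polygon. In a disc this determines
the segment, and in an annulus its lift to the universal cover. The number of crossings is
`turns.length - 1`. -/
structure Curve (S : MarkedRibbonSurface) where
  start : S.Vertex
  turns : List ℤ
  valid : S.Valid start.1 start.2.1 turns

namespace Curve

variable {S : MarkedRibbonSurface}

/-- The sides through which `c` crosses the arcs `γ₁, …, γ_{r-1}`. -/
def exits (c : S.Curve) : List S.Side := S.exitsFrom c.start.1 c.start.2.1 c.turns

/-- The vertex at which `c` ends. -/
def finish (c : S.Curve) : S.Vertex := S.endFrom c.start.1 c.start.2.1 c.turns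

/-- Elementary homotopies with fixed endpoints. `spur`: the curve crosses an arc and directly
crosses it back. `last`, `first`: at its end or start, the curve crosses an arc next to a common
endpoint with it, and this crossing is removed. -/
inductive Move : S.Curve → S.Curve → Prop
  | spur {c c' : S.Curve} {l l' : List ℤ} {a b : ℤ} : c'.start = c.start →
      c.turns = l ++ a :: 0 :: b :: l' → c'.turns = l ++ (a + b) :: l' → Move c c'
  | last {c c' : S.Curve} {l : List ℤ} {a e : ℤ} : c'.start = c.start → (e = 0 ∨ e = 1) →
      c.turns = l ++ [a, e] → c'.turns = l ++ [a + (1 - e)] → Move c c'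
  | first {c c' : S.Curve} {l : List ℤ} {d b : ℤ} : (d = 0 ∨ d = -1) →
      c.turns = d :: b :: l → c'.turns = (b - (1 + d)) :: l →
      c'.start = S.vertexAt (S.glue (S.sideAt c.start.1 (c.start.2.1 + d))).1
        ((S.glue (S.sideAt c.start.1 (c.start.2.1 + d))).2.1 + (1 + d)) → Move c c'

/-- Homotopy of curves with fixed endpoints. -/
def Homotopic : S.Curve → S.Curve → Prop := Relation.EqvGen Move

/-- The number of intersections with `Γ` is minimal up to homotopy. -/
def IsMinimal (c : S.Curve) : Prop := ∀ c', Homotopic c c' → c.turns.length ≤ c'.turns.length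

/-- Permissible curves (including the trivial ones, which do not cross `Γ`). A vertex and a side
with the same coordinate have angular distance half a side, so the numerators below are twice the
angular lengths of the end segments, measured in sides; `n Δ` sides are one turn around the
unmarked boundary component. A middle segment together with its two arcs bounds a triangle iff it
connects consecutive sides. If it has turn `1`, then the common endpoint `p(u, v, c)` of
the two arcs is on the left of `c` and `c` turns counterclockwise around it; if it has turn `-1`,
then `p(u, v, c)` is on the right and `c` turns clockwise around it. -/
structure IsPermissible (c : S.Curve) : Prop where
  minimal : c.IsMinimal
  wind_start : ∀ d d' l, c.turns = d :: d' :: l → S.holed c.start.1 = true →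
    (2 * d + 1).natAbs / (2 * S.n c.start.1) ≤ 1
  wind_finish : ∀ d l e, c.turns = d :: l ++ [e] → S.holed c.finish.1 = true →
    (2 * e - 1).natAbs / (2 * S.n c.finish.1) ≤ 1
  wind_trivial : ∀ e, c.turns = [e] → S.holed c.start.1 = true →
    (2 * e).natAbs / (2 * S.n c.start.1) ≤ 1
  middle : ∀ d ∈ c.turns.tail.dropLast, d = 1 ∨ d = -1

end Curve

/-- Permissible curves. -/
abbrev Perm (S : MarkedRibbonSurface) : Type _ := {c : S.Curve // c.IsPermissible}

/-! ### The string and the module of a permissible curve -/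

theorem shift_shift_neg (S : MarkedRibbonSurface) (g : S.Side) : S.shift (S.shift g (-1)) 1 = g := by
  obtain ⟨Δ, i, hi⟩ := g
  have h0 : (0 : ℤ) < S.n Δ := by exact_mod_cast S.n_pos Δ
  have h1 := Int.emod_nonneg ((i : ℤ) + -1) h0.ne'
  simp only [shift, sideAt]
  congr 1
  apply Fin.ext
  simp only [Int.toNat_of_nonneg h1]
  rw [Int.emod_add_emod]
  have h2 : ((i : ℤ) + -1 + 1) % (S.n Δ : ℤ) = i := by
    rw [neg_add_cancel_right]
    exact Int.emod_eq_of_lt (by omega) (by exact_mod_cast hi)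
  rw [h2]; simp

theorem hasNext_of_isSide (S : MarkedRibbonSurface) (g : S.Side) (h : S.IsSide g.1 (g.2.1 + 1)) :
    S.HasNext g := by
  rcases h with h | h
  · exact Or.inl h
  · right; have := h.2; omega

theorem hasNext_shift_of_isSide (S : MarkedRibbonSurface) (g : S.Side)
    (h : S.IsSide g.1 (g.2.1 + -1)) : S.HasNext (S.shift g (-1)) := by
  rcases h with h | h
  · exact Or.inl h
  · right
    have h2 := g.2.2
    have : ((g.2.1 : ℤ) + -1) % (S.n g.1 : ℤ) = g.2.1 + -1 :=
      Int.emod_eq_of_lt h.1 h.2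
    simp only [shift, sideAt, this]
    omega

/-- The letters of the string of a permissible curve which enters a polygon through the side `g`: a
middle segment with turn `1` gives the arrow of its corner, one with turn `-1` the formal inverse
of the arrow of its corner. -/
def lettersFrom (S : MarkedRibbonSurface) : (g : S.Side) → (l : List ℤ) → S.Valid g.1 g.2.1 l →
    (∀ d ∈ l.dropLast, d = 1 ∨ d = -1) → List (S.Arrow × Bool)
  | _, [], _, _ => []
  | _, [_], _, _ => []
  | g, d :: d' :: l, hv, hm =>
      (if hd : d = 1 then (⟨g, S.hasNext_of_isSide g (hd ▸ hv.1)⟩, true)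
        else (⟨S.shift g (-1), S.hasNext_shift_of_isSide g
          (((hm d (by simp)).resolve_left hd) ▸ hv.1)⟩, false)) ::
      lettersFrom S (S.glue (S.shift g d)) (d' :: l) hv.2
        (fun x hx => hm x (by simp [List.dropLast_cons_of_ne_nil, hx]))

theorem arc_glue (S : MarkedRibbonSurface) (g : S.Side) : S.arc (S.glue g) = S.arc g :=
  (Quot.sound (r := fun g h : S.Side => S.glue g = h) rfl).symm

theorem lettersFrom_head (S : MarkedRibbonSurface) (g : S.Side) (l : List ℤ)
    (hv : S.Valid g.1 g.2.1 l) (hm : ∀ d ∈ l.dropLast, d = 1 ∨ d = -1) :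
    ∀ a ∈ (S.lettersFrom g l hv hm).head?, (a.2 = true ∧ a.1.1 = g) ∨
      (a.2 = false ∧ a.1.1 = S.shift g (-1)) := by
  match l, hv, hm with
  | [], hv, _ => exact hv.elim
  | [_], _, _ => simp [lettersFrom]
  | d :: d' :: l, hv, hm =>
    intro a ha
    simp only [lettersFrom, List.head?_cons, Option.mem_def, Option.some.injEq] at ha
    subst ha
    by_cases hd : d = 1
    · simp [hd]
    · simp [hd]

theorem lettersFrom_chain (S : MarkedRibbonSurface) (l : List ℤ) : ∀ (g : S.Side)
    (hv : S.Valid g.1 g.2.1 l) (hm : ∀ d ∈ l.dropLast, d = 1 ∨ d = -1),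
    (S.lettersFrom g l hv hm).IsChain S.boundQuiver.Consec := by
  induction l with
  | nil => intro g hv; exact hv.elim
  | cons d l ih =>
    intro g hv hm
    match l, hv, hm, ih with
    | [], _, _, _ => simp [lettersFrom]
    | d' :: l, hv, hm, ih =>
      rw [lettersFrom, List.isChain_cons]
      refine ⟨?_, ih _ _ _⟩
      intro b hb
      have hb' := S.lettersFrom_head _ _ _ _ b hb
      have hne := S.glue_ne (S.shift g d)
      have hsh := S.shift_shift_neg (S.glue (S.shift g d))
      rcases b with ⟨⟨b, hbn⟩, y⟩
      by_cases hd : d = 1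
      · subst hd
        rcases hb' with ⟨h1, h2⟩ | ⟨h1, h2⟩ <;> simp only at h1 h2 <;> subst h1 <;> subst h2
        · refine ⟨?_, ?_, ?_, ?_⟩ <;>
            simp [BoundQuiver.tgt, BoundQuiver.src, boundQuiver, arc_glue, hne.symm]
        · refine ⟨?_, ?_, ?_, ?_⟩
          · simp [BoundQuiver.tgt, BoundQuiver.src, boundQuiver, hsh, arc_glue]
          · simp only [dite_true, Subtype.mk.injEq, not_and]
            intro h; rw [← h] at hsh; exact absurd hsh.symm hne
          · simp
          · simp
      · have hd' : d = -1 := (hm d (by simp)).resolve_left hd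
        subst hd'
        rcases hb' with ⟨h1, h2⟩ | ⟨h1, h2⟩ <;> simp only at h1 h2 <;> subst h1 <;> subst h2
        · refine ⟨?_, ?_, ?_, ?_⟩ <;>
            simp [BoundQuiver.tgt, BoundQuiver.src, boundQuiver, arc_glue, hne.symm]
        · refine ⟨?_, ?_, ?_, ?_⟩ <;>
            simp [BoundQuiver.tgt, BoundQuiver.src, boundQuiver, arc_glue, hsh, hne]

/-- The string of a permissible curve `c`, where `none` is the trivial string `0`: its vertices are
the arcs `γ₁, …, γ_{r-1}` crossed by `c`. -/
def Perm.string {S : MarkedRibbonSurface} : S.Perm → Option S.boundQuiver.Str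
  | ⟨⟨_, [], hv⟩, _⟩ => hv.elim
  | ⟨⟨_, [_], _⟩, _⟩ => none
  | ⟨⟨v, d :: d' :: l, hv⟩, hp⟩ => some
      { start := S.arc (S.sideAt v.1 (v.2.1 + d))
        letters := S.lettersFrom (S.glue (S.sideAt v.1 (v.2.1 + d))) (d' :: l) hv.2 hp.middle
        src_head := by
          intro a ha
          have h := S.lettersFrom_head _ _ _ _ a ha
          have hsh := S.shift_shift_neg (S.glue (S.sideAt v.1 (v.2.1 + d)))
          rcases a with ⟨⟨a, han⟩, y⟩
          rcases h with ⟨h1, h2⟩ | ⟨h1, h2⟩ <;> simp only at h1 h2 <;> subst h1 <;> subst h2 <;>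
            simp [BoundQuiver.src, boundQuiver, hsh, arc_glue]
        chain := S.lettersFrom_chain _ _ _ _ }

/-- The `A`-module `M(c)` of a permissible curve `c`, where `A = kQ/I` and `(Q, I)` is identified
with the bound quiver of the surface. -/
abbrev Perm.M {V E : Type*} {Q : BoundQuiver V E} {S : MarkedRibbonSurface}
    (φ : S.boundQuiver.Iso Q) (k : Type*) [CommRing k] (c : S.Perm) : Type _ :=
  BoundQuiver.StringModule k (c.string.map φ.mapStr)

/-! ### Equivalence of permissible curves -/

variable {S : MarkedRibbonSurface}

/-- The turns of the reverse of a (part of a) curve. -/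
def revTurns (l : List ℤ) : List ℤ := (l.map fun d => -d).reverse

/-- The generating cases of the equivalence of permissible curves. `rev`: reverse curves. `slide`:
the endpoint of a nontrivial curve is moved along sides in `Γ` of the polygon that contains the last
segment, the last crossing being kept (for starting points this follows by reversing). `trivial`:
the curves do not cross `Γ`. -/
inductive ElemEquiv : S.Perm → S.Perm → Prop
  | rev {c c' : S.Perm} : c'.1.start = c.1.finish → c'.1.turns = revTurns c.1.turns → ElemEquiv c c'
  | slide {c c' : S.Perm} {d e e' : ℤ} {l : List ℤ} : c'.1.start = c.1.start →
      c.1.turns = d :: l ++ [e] → c'.1.turns = d :: l ++ [e'] → ElemEquiv c c'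
  | trivial {c c' : S.Perm} : c.1.turns.length = 1 → c'.1.turns.length = 1 → ElemEquiv c c'

/-- The equivalence `c ≃ c'` of permissible curves. -/
def Equiv : S.Perm → S.Perm → Prop := Relation.EqvGen ElemEquiv

/-! ### Truncations and rotations -/

/-- For a middle segment with turn `d = ±1` from the side `γ` to the side `γ'` of a polygon, the
segment from the same point of `γ` to the end of `γ'` that is not the common vertex of the two
sides: for `d = 1`, the side `γ'` goes from the vertex `1` to the vertex `2` relative to `γ`; for
`d = -1`, it goes from the vertex `-1` to the vertex `0`. -/
def truncTurn (d : ℤ) : ℤ := if d = 1 then 2 else -1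

/-- For `c = c₁⋯c_r` crossing `γ₁, …, γ_{r-1}` and `1 ≤ m ≤ n ≤ r - 1`, the curve `c'` is
`c_m^𝔗 c_{m+1} ⋯ c_n c_{n+1}^𝔗`, which crosses `γ_m, …, γ_n`, where `c_m^𝔗` connects the endpoint of
`γ_{m-1}` that is not the vertex `p(γ_{m-1}, γ_m, c)` with `γ_m` inside the polygon of `c_m`,
dually `c_{n+1}^𝔗`, and `c_1^𝔗 = c_1`, `c_r^𝔗 = c_r`. -/
def IsTrunc (c : S.Curve) (m n : ℕ) (c' : S.Curve) : Prop :=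
  1 ≤ m ∧ m ≤ n ∧ n + 1 ≤ c.turns.length ∧ ∃ f g a b : ℤ,
    c.turns[m - 1]? = some a ∧ c.turns[n]? = some b ∧
    f = (if m = 1 then a else -truncTurn (-a)) ∧
    g = (if n + 1 = c.turns.length then b else truncTurn b) ∧
    c'.turns = f :: (c.turns.drop m).take (n - m) ++ [g] ∧
    c'.exits = (c.exits.drop (m - 1)).take (n + 1 - m) ∧
    (m = 1 → c'.start = c.start)

/-- Concatenation of two (parts of) curves at a common vertex or crossing point, where the last
segment of the first and the first segment of the second, in the same polygon, become one. -/
def joinTurns (l l' : List ℤ) : List ℤ :=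
  l.dropLast ++ (l.getLastD 0 + l'.headD 0) :: l'.tail

/-- The step from a vertex of a polygon to the next one in the positive direction of the boundary
(with the interior on the left, that is, counterclockwise around the polygon). -/
def posStep (S : MarkedRibbonSurface) (v : S.Vertex) : ℤ :=
  if S.holed v.1 = false ∧ v.2.1 = 0 then (S.numVert v.1 : ℤ) - 1 else -1

/-- The step from a vertex of a polygon to the next one in the negative direction. -/
def negStep (S : MarkedRibbonSurface) (v : S.Vertex) : ℤ :=
  if S.holed v.1 = false ∧ v.2.1 + 1 = S.numVert v.1 then 1 - (S.numVert v.1 : ℤ) else 1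

/-- `c'` is obtained from `c` by moving the endpoint of `c` to the next vertex of the last polygon,
in the direction given by `step`. -/
def MoveEnd (step : S.Vertex → ℤ) (c c' : S.Curve) : Prop :=
  c'.start = c.start ∧ c'.turns = joinTurns c.turns [step c.finish]

/-- Rotation of type 1: `c₃ = prot_c(c₂)`, where `c` turns from `γ' = γ_i` to `γ'' = γ_{i+1}`, and
`c₂ = c₁⋯c_i c_{i+1}^𝔗` has the starting point of `c` as common endpoint with `c`.
This endpoint of `c₂` is moved along `c` to the other endpoint of `c`; the other endpoint of `c₂` is
moved in the positive direction of the boundary to a vertex of the polygon containing `c_{i+1}` such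
that `c₃` crosses `γ''`, entering this polygon through it. -/
def IsProtOne (c : S.Curve) (i : ℕ) (c₂ c₃ : S.Curve) : Prop :=
  IsTrunc c 1 i c₂ ∧ ∃ w w' : S.Curve,
    w.start = c.finish ∧ w.turns = joinTurns (revTurns c.turns) c₂.turns ∧
    Relation.TransGen (MoveEnd S.posStep) w w' ∧ Curve.Homotopic w' c₃ ∧
    c₃.finish = w'.finish ∧ ∃ h, c.exits[i]? = some h ∧ c₃.exits.getLast? = some (S.glue h)

/-- Rotation of type 2 of the part `c₂_I` of `c₂` before its `i₂`-th crossing, which is the `i`-th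
crossing of `c`, where `c` and `c₂` meet: the end of `c₂_I` at this crossing is moved along `c` to the
starting point of `c`, and the starting point of `c₂` is moved to the next vertex of its polygon, in
the direction given by `step`. -/
def IsRotFirst (step : S.Vertex → ℤ) (c : S.Curve) (i : ℕ) (c₂ : S.Curve) (i₂ : ℕ)
    (c₃ : S.Curve) : Prop :=
  ∃ w w' : S.Curve, w.start = c.start ∧
    w.turns = joinTurns (c.turns.take i) (revTurns (c₂.turns.take i₂)) ∧
    MoveEnd step w w' ∧ Curve.Homotopic w' c₃

/-- Rotation of type 2 of the part `c₂_II` of `c₂` after its `i₂`-th crossing, which is the `i`-th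
crossing of `c`: the end of `c₂_II` at this crossing is moved along `c` to the endpoint of `c`, and the
endpoint of `c₂` is moved to the next vertex of its polygon, in the direction given by `step`. -/
def IsRotSecond (step : S.Vertex → ℤ) (c : S.Curve) (i : ℕ) (c₂ : S.Curve) (i₂ : ℕ)
    (c₃ : S.Curve) : Prop :=
  ∃ w w' : S.Curve, w.start = c.finish ∧
    w.turns = joinTurns (revTurns (c.turns.drop i)) (c₂.turns.drop i₂) ∧
    MoveEnd step w w' ∧ Curve.Homotopic w' c₃

/-! ### The three configurations -/

/-- Case I: `c` consecutively crosses `γ' = γ_i` and `γ'' = γ_{i+1}` with common endpoint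
`p(γ', γ'', c)` on the right of `c`; `c'` goes with `c` from its starting point across `γ'` and then
ends at the other endpoint of `γ''`; and `c'' ≃ prot_c(c')`. -/
def CaseI (c c' c'' : S.Perm) : Prop :=
  ∃ i : ℕ, 1 ≤ i ∧ i + 2 ≤ c.1.turns.length ∧ c.1.turns[i]? = some (-1) ∧
    ∃ c₂ c₃ : S.Perm, IsTrunc c.1 1 i c₂.1 ∧ Equiv c' c₂ ∧
      IsProtOne c.1 i c₂.1 c₃.1 ∧ Equiv c'' c₃

/-- `c` turns around the endpoint of `γ_i` on its left (if `d = 1`, right if `d = -1`) from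
`γ_{m-1}` (if `m > 1`), `γ_m` up to `γ_i`, and around the endpoint of `γ_i` on its right (left) from
`γ_i` up to `γ_n`, `γ_{n+1}` (if `n < r - 1`). -/
def TurnsAt (d : ℤ) (c : S.Curve) (m i n : ℕ) : Prop :=
  1 ≤ m ∧ m ≤ i ∧ i ≤ n ∧ n + 1 ≤ c.turns.length ∧
    (∀ j, m ≤ j + 1 → 1 ≤ j → j < i → c.turns[j]? = some d) ∧
    (∀ j, i ≤ j → j ≤ n → j + 1 < c.turns.length → c.turns[j]? = some (-d))

/-- Cases II and III: `c₁` is equivalent to the truncation of `c` to `γ_m, …, γ_n`, and the curves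
`x`, `y` are equivalent to the rotations of its two parts with respect to `c`. -/
def CaseTwoSided (d : ℤ) (step : S.Vertex → ℤ) (c c₁ x y : S.Perm) : Prop :=
  ∃ m i n : ℕ, TurnsAt d c.1 m i n ∧ ∃ c₂ : S.Perm, IsTrunc c.1 m n c₂.1 ∧ Equiv c₁ c₂ ∧
    (∃ x' : S.Perm, IsRotFirst step c.1 i c₂.1 (i + 1 - m) x'.1 ∧ Equiv x x') ∧
    (∃ y' : S.Perm, IsRotSecond step c.1 i c₂.1 (i + 1 - m) y'.1 ∧ Equiv y y')

/-- Case II: `γ_m, …, γ_i` have a common endpoint on the left of `c`, `γ_i, …, γ_n` have a common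
endpoint on the right of `c`, `c'` is the truncation of `c` to `γ_m, …, γ_n`, and `x`, `y` are the
positive rotations with respect to `c` of the two parts of `c'`. -/
def CaseII (c c' x y : S.Perm) : Prop := CaseTwoSided 1 S.posStep c c' x y

/-- Case III: as Case II, with left and right exchanged and with negative rotations. -/
def CaseIII (c c'' x y : S.Perm) : Prop := CaseTwoSided (-1) S.negStep c c'' x y

end MarkedRibbonSurface

/-- There is a short exact sequence `0 → L → M → N → 0` of `R`-modules. -/
def HasShortExact (R : Type*) [Ring R] (L M N : Type*) [AddCommGroup L] [AddCommGroup M]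
    [AddCommGroup N] [Module R L] [Module R M] [Module R N] : Prop :=
  ∃ (f : L →ₗ[R] M) (g : M →ₗ[R] N),
    Function.Injective f ∧ Function.Exact f g ∧ Function.Surjective g

/-! The positions of the string of `c` are its crossings, numbered from 0. A set of positions that
no arrow of the string leaves spans a submodule of `M(c)`; a set that no arrow enters gives a
quotient. In Case I the letter between the positions `i - 1` and `i` is inverse, so the positions `q
< i` span a submodule and the positions `q ≥ i` carry the quotient. In Case II both boundary letters
point into the interval `m - 1 ≤ q < n`, which spans a submodule; what is left over falls into two
unlinked pieces, and the quotient is a direct sum. Case III has the arrows reversed.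
`hasShortExact_of_occurs`, `hasShortExact_prod_right` and `hasShortExact_prod_left` turn such
partitions into exact sequences.

It remains to see which positions each curve carries. A truncation crosses the same sides with the
same turns as `c` (`IsTrunc.occurs`). A rotated curve runs along `c` and back along the truncation.
The common part is a nest of spurs, and removing it (`spursTo_joinTurns`) leaves an outer part of
`c` or of its reverse, followed by one last segment. That segment does not end at an end of the side
through which its polygon is entered, so no homotopy move applies any more.

The given representative of the rotation is only known to be permissible and homotopic to this
curve. The moves shorten curves and satisfy a diamond property once trivial curves are identified
(`Step.joins`), so irreducible representatives of a nontrivial class are unique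
(`Homotopic.eq_of_irreducible`). A permissible curve is minimal, hence irreducible, and the two
coincide. Equivalence of curves preserves strings up to reading direction (`Equiv.occurs`). -/

namespace BoundQuiver

/-! ### Submodules and quotients of string modules given by sets of positions -/

section Modules

variable {V E V' E' : Type*} {Q : BoundQuiver V E} {Q' : BoundQuiver V' E'}

/-- The positions of `s` which satisfy `P` carry a copy of `s'`, possibly with the positions in a
different order. -/
def Occurs (s' s : Option Q.Str) (P : ℕ → Prop) : Prop :=
  ∃ ι : Fin (size s') → Fin (size s), Function.Injective ι ∧ (∀ q : Fin (size s), P q ↔ ∃ p, ι p = q) ∧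
    (∀ (p : Fin (size s')) v, AtVertex s' p v ↔ AtVertex s (ι p) v) ∧
    ∀ (α : E) (p q : Fin (size s')), Leads α s' p q ↔ Leads α s (ι p) (ι q)

theorem Occurs.trans {s'' s' s : Option Q.Str} {P : ℕ → Prop} (h : Occurs s'' s' fun _ => True)
    (h' : Occurs s' s P) : Occurs s'' s P := by
  obtain ⟨ι, hi, hr, hv, hl⟩ := h
  obtain ⟨κ, ki, kr, kv, kl⟩ := h'
  refine ⟨κ ∘ ι, ki.comp hi, fun q => ?_, fun p v => (hv p v).trans (kv _ v),
    fun α p q => (hl α p q).trans (kl α _ _)⟩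
  rw [kr]
  constructor
  · rintro ⟨p, rfl⟩
    obtain ⟨p, rfl⟩ := (hr p).1 trivial
    exact ⟨p, rfl⟩
  · rintro ⟨p, rfl⟩
    exact ⟨ι p, rfl⟩

theorem Occurs.refl (s : Option Q.Str) : Occurs s s fun _ => True :=
  ⟨id, Function.injective_id, by simp, by simp, by simp⟩

theorem Occurs.symm {s' s : Option Q.Str} (h : Occurs s' s fun _ => True) :
    Occurs s s' fun _ => True := by
  obtain ⟨ι, hi, hr, hv, hl⟩ := h
  have hb : Function.Bijective ι := ⟨hi, fun q => (hr q).1 trivial⟩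
  let e := Equiv.ofBijective ι hb
  have he : ∀ p, ι (e.symm p) = p := e.apply_symm_apply
  refine ⟨e.symm, e.symm.injective, fun q => ⟨fun _ => e.symm.surjective q, fun _ => trivial⟩,
    fun p v => ?_, fun α p q => ?_⟩
  · rw [hv, he]
  · rw [hl, he, he]

theorem Occurs.none (s : Option Q.Str) {P : ℕ → Prop} (hP : ∀ q < size s, ¬ P q) :
    Occurs Option.none s P :=
  ⟨fun p => p.elim0, fun p => p.elim0, fun q => ⟨fun h => (hP q q.2 h).elim, fun ⟨p, _⟩ => p.elim0⟩,
    fun p => p.elim0, fun _ p => p.elim0⟩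

theorem Occurs.congr {s' s : Option Q.Str} {P P' : ℕ → Prop} (h : Occurs s' s P)
    (hP : ∀ q < size s, P q ↔ P' q) : Occurs s' s P' := by
  obtain ⟨ι, hi, hr, hv, hl⟩ := h
  exact ⟨ι, hi, fun q => (hP q q.2).symm.trans (hr q), hv, hl⟩

theorem size_map (φ : Q.Iso Q') (s : Option Q.Str) : size (s.map φ.mapStr) = size s := by
  cases s <;> simp [size, Iso.mapStr]

theorem tgt_map (φ : Q.Iso Q') (a : E × Bool) : Q'.tgt (φ.arr a.1, a.2) = φ.vert (Q.tgt a) := by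
  rcases a with ⟨a, _ | _⟩ <;> simp [tgt, φ.map_s, φ.map_t]

theorem atVertex_map (φ : Q.Iso Q') (s : Option Q.Str) (p : ℕ) (v : V') :
    AtVertex (s.map φ.mapStr) p v ↔ AtVertex s p (φ.vert.symm v) := by
  cases s with
  | none => simp [AtVertex]
  | some u =>
    cases p with
    | zero => simp [AtVertex, Iso.mapStr, Equiv.eq_symm_apply]
    | succ p =>
      simp only [AtVertex, Iso.mapStr, Option.map_some, List.getElem?_map, Option.map_eq_some_iff,
        Equiv.eq_symm_apply]
      constructor
      · rintro ⟨_, ⟨a, ha, rfl⟩, h⟩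
        exact ⟨a, ha, by rw [← h, tgt_map]⟩
      · rintro ⟨a, ha, h⟩
        exact ⟨_, ⟨a, ha, rfl⟩, by rw [← h, tgt_map]⟩

theorem leads_map (φ : Q.Iso Q') (s : Option Q.Str) (α : E') (p q : ℕ) :
    Leads α (s.map φ.mapStr) p q ↔ Leads (φ.arr.symm α) s p q := by
  cases s with
  | none => simp [Leads]
  | some u =>
    simp only [Leads, Iso.mapStr, Option.map_some, List.getElem?_map, Option.map_eq_some_iff,
      Prod.mk.injEq, Prod.exists, ← Equiv.eq_symm_apply]
    simp

theorem Occurs.map (φ : Q.Iso Q') {s' s : Option Q.Str} {P : ℕ → Prop} (h : Occurs s' s P) :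
    Occurs (s'.map φ.mapStr) (s.map φ.mapStr) P := by
  obtain ⟨ι, hi, hr, hv, hl⟩ := h
  refine ⟨fun p => Fin.cast (size_map φ s).symm (ι (Fin.cast (size_map φ s') p)), ?_, fun q => ?_,
    fun p v => ?_, fun α p q => ?_⟩
  · intro p q h
    simpa using hi (Fin.cast_injective _ h)
  · rw [show P q ↔ P (Fin.cast (size_map φ s) q) from Iff.rfl, hr]
    constructor
    · rintro ⟨p, hp⟩
      exact ⟨Fin.cast (size_map φ s').symm p, by simp [hp]⟩
    · rintro ⟨p, rfl⟩
      exact ⟨Fin.cast (size_map φ s') p, by simp⟩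
  · rw [atVertex_map, atVertex_map]; exact hv (Fin.cast (size_map φ s') p) _
  · rw [leads_map, leads_map]
    exact hl _ (Fin.cast (size_map φ s') p) (Fin.cast (size_map φ s') q)

variable (k : Type*) [CommRing k]

theorem stringRep_mkAlgHom [Fintype V] (s : Option Q.Str) (x : FreeAlgebra k (V ⊕ E)) :
    stringRep k s (RingQuot.mkAlgHom k (AlgRel k Q) x) = FreeAlgebra.lift k (genMatrix k s) x := by
  simp [stringRep]

/-- The algebra is a quotient of a free algebra, so commutation needs to be checked on the
generators only. -/
theorem stringRep_intertwine [Fintype V] {s s' : Option Q.Str}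
    {F : Matrix (Fin (size s)) (Fin (size s')) k}
    (hF : ∀ x, genMatrix k s x * F = F * genMatrix k s' x) (a : Q.Algebra k) :
    stringRep k s a * F = F * stringRep k s' a := by
  obtain ⟨x, rfl⟩ := RingQuot.mkAlgHom_surjective k (AlgRel k Q) a
  rw [stringRep_mkAlgHom, stringRep_mkAlgHom]
  induction x using FreeAlgebra.induction with
  | grade0 r => simp [Algebra.algebraMap_eq_smul_one]
  | grade1 x => simpa using hF x
  | mul x y hx hy =>
    rw [map_mul, map_mul, Matrix.mul_assoc, hy, ← Matrix.mul_assoc, hx, Matrix.mul_assoc]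
  | add x y hx hy => rw [map_add, map_add, Matrix.add_mul, Matrix.mul_add, hx, hy]

/-- The homomorphism between string modules given by a matrix. -/
noncomputable def homOfMatrix [Fintype V] {s s' : Option Q.Str}
    (F : Matrix (Fin (size s)) (Fin (size s')) k)
    (hF : ∀ x, genMatrix k s x * F = F * genMatrix k s' x) :
    StringModule k s →ₗ[(Q.Algebra k)ᵐᵒᵖ] StringModule k s' where
  toFun x := Matrix.vecMul x F
  map_add' x y := Matrix.add_vecMul _ _ _
  map_smul' a x := by
    change Matrix.vecMul (Matrix.vecMul x (stringRep k s a.unop)) F =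
      Matrix.vecMul (Matrix.vecMul x F) (stringRep k s' a.unop)
    refine (Matrix.vecMul_vecMul (α := k) x _ _).trans ?_
    rw [stringRep_intertwine k hF]
    exact (Matrix.vecMul_vecMul (α := k) x _ _).symm

/-- The coordinates of an element of a string module. -/
def StringModule.coord {s : Option Q.Str} (x : StringModule k s) (p : Fin (size s)) : k := x p

/-- Matrices act on row vectors: an arrow that leads from `p` to `q` sends the basis vector at `p`
to the one at `q`. Closure of `P` under arrows is therefore what makes its span a submodule. -/
theorem Occurs.exists_incl [Fintype V] {s' s : Option Q.Str} {P : ℕ → Prop} (h : Occurs s' s P)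
    (hP : ∀ α p q, Leads α s p q → P p → P q) :
    ∃ f : StringModule k s' →ₗ[(Q.Algebra k)ᵐᵒᵖ] StringModule k s,
      ∃ ι : Fin (size s') → Fin (size s), Function.Injective ι ∧ (∀ q : Fin (size s), P q ↔ ∃ p, ι p = q) ∧
        (∀ x p, (f x).coord k (ι p) = x.coord k p) ∧
        ∀ x (q : Fin (size s)), ¬ P q → (f x).coord k q = 0 := by
  classical
  obtain ⟨ι, hi, hr, hv, hl⟩ := h
  let F : Matrix (Fin (size s')) (Fin (size s)) k := fun p q => if ι p = q then 1 else 0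
  have hF : ∀ x, genMatrix k s' x * F = F * genMatrix k s x := by
    intro x
    ext p q
    have h1 : (F * genMatrix k s x) p q = genMatrix k s x (ι p) q := by
      rw [Matrix.mul_apply, Finset.sum_eq_single (ι p)] <;> simp +contextual [F, eq_comm]
    rw [h1, Matrix.mul_apply]
    by_cases hq : ∃ p', ι p' = q
    · obtain ⟨q, rfl⟩ := hq
      rw [Finset.sum_eq_single q]
      · cases x with
        | inl v => simp [genMatrix, F, hi.eq_iff, hv]
        | inr α => simp [genMatrix, F, hl]
      · intro b _ hb; simp [F, hi.eq_iff, hb]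
      · simp
    -- A position outside the image receives nothing from `P`, because `P` is closed under arrows.
    · rw [Finset.sum_eq_zero]
      · cases x with
        | inl v =>
          have : ¬ (ι p = q ∧ AtVertex s (ι p) v) := fun h => hq ⟨p, h.1⟩
          simp only [genMatrix, if_neg this]
        | inr α =>
          have : ¬ Leads α s (ι p) q := fun h => hq ((hr q).1 (hP _ _ _ h ((hr _).2 ⟨p, rfl⟩)))
          simp only [genMatrix, if_neg this]
      · intro b _
        have : ι b ≠ q := fun h => hq ⟨b, h⟩
        simp [F, this]
  refine ⟨homOfMatrix k F hF, ι, hi, hr, fun x p => ?_, fun x q hq => ?_⟩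
  · change (∑ b, x b * F b (ι p)) = x p
    rw [Finset.sum_eq_single p]
    · simp [F]
    · intro b _ hb; simp [F, hi.eq_iff, hb]
    · simp
  · change (∑ b, x b * F b q) = 0
    refine Finset.sum_eq_zero fun b _ => ?_
    have : ι b ≠ q := fun h => hq ((hr q).2 ⟨b, h⟩)
    simp [F, this]

/-- Forgetting the coordinates outside `P` is linear over the algebra because no arrow enters `P`
from outside. -/
theorem Occurs.exists_proj [Fintype V] {s' s : Option Q.Str} {P : ℕ → Prop} (h : Occurs s' s P)
    (hP : ∀ α p q, Leads α s p q → P q → P p) :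
    ∃ g : StringModule k s →ₗ[(Q.Algebra k)ᵐᵒᵖ] StringModule k s',
      ∃ ι : Fin (size s') → Fin (size s), Function.Injective ι ∧ (∀ q : Fin (size s), P q ↔ ∃ p, ι p = q) ∧
        ∀ x p, (g x).coord k p = x.coord k (ι p) := by
  classical
  obtain ⟨ι, hi, hr, hv, hl⟩ := h
  let F : Matrix (Fin (size s)) (Fin (size s')) k := fun q p => if q = ι p then 1 else 0
  have hF : ∀ x, genMatrix k s x * F = F * genMatrix k s' x := by
    intro x
    ext q p
    have h1 : (genMatrix k s x * F) q p = genMatrix k s x q (ι p) := by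
      rw [Matrix.mul_apply, Finset.sum_eq_single (ι p)] <;> simp +contextual [F]
    rw [h1, Matrix.mul_apply]
    by_cases hq : ∃ p', ι p' = q
    · obtain ⟨q, rfl⟩ := hq
      rw [Finset.sum_eq_single q]
      · cases x with
        | inl v => simp [genMatrix, F, hi.eq_iff, hv]
        | inr α => simp [genMatrix, F, hl]
      · intro b _ hb; simp [F, hi.eq_iff, hb.symm]
      · simp
    · rw [Finset.sum_eq_zero]
      · cases x with
        | inl v =>
          have : ¬ (q = ι p ∧ AtVertex s q v) := fun h => hq ⟨p, h.1.symm⟩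
          simp only [genMatrix, if_neg this]
        | inr α =>
          have : ¬ Leads α s q (ι p) := fun h => hq ((hr q).1 (hP _ _ _ h ((hr _).2 ⟨p, rfl⟩)))
          simp only [genMatrix, if_neg this]
      · intro b _
        have : q ≠ ι b := fun h => hq ⟨b, h.symm⟩
        simp [F, this]
  refine ⟨homOfMatrix k F hF, ι, hi, hr, fun x p => ?_⟩
  change (∑ b, x b * F b p) = x (ι p)
  rw [Finset.sum_eq_single (ι p)]
  · simp [F]
  · intro b _ hb; simp [F, hb]
  · simp

variable {k}

theorem StringModule.coord_ext {s : Option Q.Str} {x y : StringModule k s}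
    (h : ∀ p, x.coord k p = y.coord k p) : x = y := funext h

theorem StringModule.exists_coord {s : Option Q.Str} (x : Fin (size s) → k) :
    ∃ y : StringModule k s, ∀ p, y.coord k p = x p := ⟨x, fun _ => rfl⟩

theorem StringModule.coord_zero {s : Option Q.Str} (p : Fin (size s)) :
    (0 : StringModule k s).coord k p = 0 := rfl

theorem StringModule.coord_add {s : Option Q.Str} (x y : StringModule k s) (p : Fin (size s)) :
    (x + y).coord k p = x.coord k p + y.coord k p := rfl

variable (k)

open StringModule

theorem hasShortExact_of_occurs [Fintype V] {s s' s'' : Option Q.Str} {P : ℕ → Prop}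
    (h' : Occurs s' s P) (h'' : Occurs s'' s fun p => ¬ P p)
    (hP : ∀ α p q, Leads α s p q → P p → P q) :
    HasShortExact (Q.Algebra k)ᵐᵒᵖ (StringModule k s') (StringModule k s) (StringModule k s'') := by
  obtain ⟨f, ι, hi, hr, hf, hf0⟩ := h'.exists_incl k hP
  obtain ⟨g, κ, ki, kr, hg⟩ := h''.exists_proj k fun α p q h hq hp => hq (hP α p q h hp)
  refine ⟨f, g, fun x y hxy => coord_ext fun p => by rw [← hf, hxy, hf], fun y => ?_, fun z => ?_⟩
  · constructor
    · intro hy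
      obtain ⟨x, hx⟩ := exists_coord (k := k) (s := s') fun p => y.coord k (ι p)
      refine ⟨x, coord_ext fun q => ?_⟩
      by_cases hq : P q
      · obtain ⟨p, rfl⟩ := (hr q).1 hq
        rw [hf, hx]
      · obtain ⟨p, rfl⟩ := (kr q).1 hq
        rw [hf0 _ _ hq, ← hg, hy, coord_zero]
    · rintro ⟨x, rfl⟩
      refine coord_ext fun p => ?_
      rw [hg, hf0 _ _ ((kr _).2 ⟨p, rfl⟩), coord_zero]
  · obtain ⟨y, hy⟩ := exists_coord (k := k) (s := s) (Function.extend κ (z.coord k) 0)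
    exact ⟨y, coord_ext fun p => by rw [hg, hy, ki.extend_apply]⟩

/-- The positions outside `P` split into two sets that no arrow enters, so the two coordinate
projections together form the quotient map, with kernel the vectors supported on `P`. -/
theorem hasShortExact_prod_right [Fintype V] {s s' x y : Option Q.Str} {P P₁ P₂ : ℕ → Prop}
    (h' : Occurs s' s P) (hx : Occurs x s P₁) (hy : Occurs y s P₂)
    (hP : ∀ α p q, Leads α s p q → P p → P q) (hP₁ : ∀ α p q, Leads α s p q → P₁ q → P₁ p)
    (hP₂ : ∀ α p q, Leads α s p q → P₂ q → P₂ p) (hc : ∀ q, P q ↔ ¬ P₁ q ∧ ¬ P₂ q)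
    (hd : ∀ q, P₁ q → ¬ P₂ q) :
    HasShortExact (Q.Algebra k)ᵐᵒᵖ (StringModule k s') (StringModule k s)
      (StringModule k x × StringModule k y) := by
  classical
  obtain ⟨f, ι, hi, hr, hf, hf0⟩ := h'.exists_incl k hP
  obtain ⟨g₁, κ₁, ki₁, kr₁, hg₁⟩ := hx.exists_proj k hP₁
  obtain ⟨g₂, κ₂, ki₂, kr₂, hg₂⟩ := hy.exists_proj k hP₂
  refine ⟨f, g₁.prod g₂, fun x y hxy => coord_ext fun p => by rw [← hf, hxy, hf], fun y => ?_,
    fun z => ?_⟩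
  · constructor
    · intro hy
      have hy₁ : g₁ y = 0 := congrArg Prod.fst hy
      have hy₂ : g₂ y = 0 := congrArg Prod.snd hy
      obtain ⟨x, hx⟩ := exists_coord (k := k) (s := s') fun p => y.coord k (ι p)
      refine ⟨x, coord_ext fun q => ?_⟩
      by_cases hq : P q
      · obtain ⟨p, rfl⟩ := (hr q).1 hq
        rw [hf, hx]
      · rw [hf0 _ _ hq]
        by_cases hq₁ : P₁ q
        · obtain ⟨p, rfl⟩ := (kr₁ q).1 hq₁
          rw [← hg₁, hy₁, coord_zero]
        · have hq₂ : P₂ q := by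
            by_contra h
            exact hq ((hc q).2 ⟨hq₁, h⟩)
          obtain ⟨p, rfl⟩ := (kr₂ q).1 hq₂
          rw [← hg₂, hy₂, coord_zero]
    · rintro ⟨x, rfl⟩
      refine Prod.ext (coord_ext fun p => ?_) (coord_ext fun p => ?_)
      · change (g₁ (f x)).coord k p = 0
        rw [hg₁, hf0 _ _ fun h => ((hc _).1 h).1 ((kr₁ _).2 ⟨p, rfl⟩)]
      · change (g₂ (f x)).coord k p = 0
        rw [hg₂, hf0 _ _ fun h => ((hc _).1 h).2 ((kr₂ _).2 ⟨p, rfl⟩)]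
  -- Since `P₁` and `P₂` are disjoint, both components can be prescribed at once; on `P` the value
  -- is the default 0.
  · obtain ⟨y, hy⟩ := exists_coord (k := k) (s := s) fun q =>
      if P₁ q then Function.extend κ₁ (z.1.coord k) 0 q else Function.extend κ₂ (z.2.coord k) 0 q
    refine ⟨y, Prod.ext (coord_ext fun p => ?_) (coord_ext fun p => ?_)⟩
    · change (g₁ y).coord k p = _
      rw [hg₁, hy, if_pos ((kr₁ _).2 ⟨p, rfl⟩), ki₁.extend_apply]
    · change (g₂ y).coord k p = _
      rw [hg₂, hy, if_neg fun h => hd _ h ((kr₂ _).2 ⟨p, rfl⟩), ki₂.extend_apply]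

theorem hasShortExact_prod_left [Fintype V] {s s'' x y : Option Q.Str} {P P₁ P₂ : ℕ → Prop}
    (h'' : Occurs s'' s P) (hx : Occurs x s P₁) (hy : Occurs y s P₂)
    (hP : ∀ α p q, Leads α s p q → P q → P p) (hP₁ : ∀ α p q, Leads α s p q → P₁ p → P₁ q)
    (hP₂ : ∀ α p q, Leads α s p q → P₂ p → P₂ q) (hc : ∀ q, P q ↔ ¬ P₁ q ∧ ¬ P₂ q)
    (hd : ∀ q, P₁ q → ¬ P₂ q) :
    HasShortExact (Q.Algebra k)ᵐᵒᵖ (StringModule k x × StringModule k y) (StringModule k s)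
      (StringModule k s'') := by
  classical
  obtain ⟨g, κ, ki, kr, hg⟩ := h''.exists_proj k hP
  obtain ⟨f₁, ι₁, hi₁, hr₁, hf₁, hz₁⟩ := hx.exists_incl k hP₁
  obtain ⟨f₂, ι₂, hi₂, hr₂, hf₂, hz₂⟩ := hy.exists_incl k hP₂
  have e₁ : ∀ z p, ((f₁.coprod f₂) z).coord k (ι₁ p) = z.1.coord k p := fun z p => by
    rw [LinearMap.coprod_apply, coord_add, hf₁, hz₂ _ _ (hd _ ((hr₁ _).2 ⟨p, rfl⟩)), add_zero]
  have e₂ : ∀ z p, ((f₁.coprod f₂) z).coord k (ι₂ p) = z.2.coord k p := fun z p => by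
    rw [LinearMap.coprod_apply, coord_add, hf₂, hz₁ _ _ fun h => hd _ h ((hr₂ _).2 ⟨p, rfl⟩),
      zero_add]
  have e₀ : ∀ z (q : Fin (size s)), P q → ((f₁.coprod f₂) z).coord k q = 0 := fun z q hq => by
    rw [LinearMap.coprod_apply, coord_add, hz₁ _ _ ((hc q).1 hq).1, hz₂ _ _ ((hc q).1 hq).2,
      add_zero]
  refine ⟨f₁.coprod f₂, g, fun z z' h => Prod.ext (coord_ext fun p => by rw [← e₁, h, e₁])
    (coord_ext fun p => by rw [← e₂, h, e₂]), fun y => ?_, fun z => ?_⟩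
  · constructor
    · intro hy
      obtain ⟨x₁, hx₁⟩ := exists_coord (k := k) (s := x) fun p => y.coord k (ι₁ p)
      obtain ⟨x₂, hx₂⟩ := exists_coord (k := k) fun p => y.coord k (ι₂ p)
      refine ⟨(x₁, x₂), coord_ext fun q => ?_⟩
      by_cases hq : P q
      · rw [e₀ _ _ hq]
        obtain ⟨p, rfl⟩ := (kr q).1 hq
        rw [← hg, hy, coord_zero]
      · by_cases hq₁ : P₁ q
        · obtain ⟨p, rfl⟩ := (hr₁ q).1 hq₁
          rw [e₁, hx₁]
        · have hq₂ : P₂ q := by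
            by_contra h
            exact hq ((hc q).2 ⟨hq₁, h⟩)
          obtain ⟨p, rfl⟩ := (hr₂ q).1 hq₂
          rw [e₂, hx₂]
    · rintro ⟨x, rfl⟩
      refine coord_ext fun p => ?_
      rw [hg, e₀ _ _ ((kr _).2 ⟨p, rfl⟩), coord_zero]
  · obtain ⟨y, hy⟩ := exists_coord (k := k) (s := s) (Function.extend κ (z.coord k) 0)
    exact ⟨y, coord_ext fun p => by rw [hg, hy, ki.extend_apply]⟩

end Modules

end BoundQuiver

namespace MarkedRibbonSurface

/-! ### Coordinates of sides and vertices in a polygon -/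

section Coordinates

variable {S : MarkedRibbonSurface}

/-- The coordinates `i`, `j` describe the same side or vertex of `Δ`. -/
def SameCoord (S : MarkedRibbonSurface) (Δ : S.Poly) (i j : ℤ) : Prop :=
  i = j ∨ S.holed Δ = true ∧ i ≡ j [ZMOD S.n Δ]

theorem SameCoord.modEq {Δ : S.Poly} {i j : ℤ} (h : S.SameCoord Δ i j) : i ≡ j [ZMOD S.n Δ] := by
  rcases h with rfl | h
  · rfl
  · exact h.2

theorem SameCoord.symm {Δ : S.Poly} {i j : ℤ} (h : S.SameCoord Δ i j) : S.SameCoord Δ j i :=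
  h.imp Eq.symm fun h => ⟨h.1, h.2.symm⟩

theorem SameCoord.add {Δ : S.Poly} {i j : ℤ} (h : S.SameCoord Δ i j) (d : ℤ) :
    S.SameCoord Δ (i + d) (j + d) :=
  h.imp (congrArg (· + d)) fun h => ⟨h.1, h.2.add_right d⟩

theorem sideAt_congr {Δ : S.Poly} {i j : ℤ} (h : i ≡ j [ZMOD S.n Δ]) :
    S.sideAt Δ i = S.sideAt Δ j := by
  simp only [sideAt, h.eq]

theorem vertexAt_congr {Δ : S.Poly} {i j : ℤ} (h : S.SameCoord Δ i j) :
    S.vertexAt Δ i = S.vertexAt Δ j := by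
  rcases h with rfl | ⟨h, h'⟩
  · rfl
  · have : S.numVert Δ = S.n Δ := by simp [numVert, h]
    simp only [vertexAt, this, h'.eq]

theorem isSide_congr {Δ : S.Poly} {i j : ℤ} (h : S.SameCoord Δ i j) :
    S.IsSide Δ i ↔ S.IsSide Δ j := by
  rcases h with rfl | ⟨h, -⟩
  · rfl
  · simp [IsSide, h]

theorem isVertex_congr {Δ : S.Poly} {i j : ℤ} (h : S.SameCoord Δ i j) :
    S.IsVertex Δ i ↔ S.IsVertex Δ j := by
  rcases h with rfl | ⟨h, -⟩
  · rfl
  · simp [IsVertex, h]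

theorem coe_sideAt (Δ : S.Poly) (i : ℤ) : ((S.sideAt Δ i).2.1 : ℤ) = i % S.n Δ := by
  have h0 : (0 : ℤ) < S.n Δ := by exact_mod_cast S.n_pos Δ
  exact Int.toNat_of_nonneg (Int.emod_nonneg i h0.ne')

theorem coe_vertexAt (Δ : S.Poly) (i : ℤ) : ((S.vertexAt Δ i).2.1 : ℤ) = i % S.numVert Δ := by
  have h0 : (0 : ℤ) < S.numVert Δ := by exact_mod_cast S.numVert_pos Δ
  exact Int.toNat_of_nonneg (Int.emod_nonneg i h0.ne')

theorem sameCoord_sideAt {Δ : S.Poly} {i : ℤ} (h : S.IsSide Δ i) :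
    S.SameCoord Δ (S.sideAt Δ i).2.1 i := by
  rw [SameCoord, coe_sideAt]
  rcases h with h | h
  · exact Or.inr ⟨h, Int.mod_modEq _ _⟩
  · exact Or.inl (Int.emod_eq_of_lt h.1 h.2)

theorem sameCoord_vertexAt {Δ : S.Poly} {i : ℤ} (h : S.IsVertex Δ i) :
    S.SameCoord Δ (S.vertexAt Δ i).2.1 i := by
  rw [SameCoord, coe_vertexAt]
  rcases h with h | h
  · have : S.numVert Δ = S.n Δ := by simp [numVert, h]
    rw [this]
    exact Or.inr ⟨h, Int.mod_modEq _ _⟩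
  · exact Or.inl (Int.emod_eq_of_lt h.1 h.2)

theorem n_lt_numVert {Δ : S.Poly} (h : S.holed Δ = false) : S.n Δ < S.numVert Δ := by
  simp only [numVert, h]
  split_ifs <;> simp_all

theorem sideAt_self (g : S.Side) : S.sideAt g.1 g.2.1 = g := by
  obtain ⟨Δ, i, hi⟩ := g
  have : ((i : ℤ) % (S.n Δ : ℤ)) = i := Int.emod_eq_of_lt (by omega) (by exact_mod_cast hi)
  simp [sideAt, this]

theorem isSide_self (g : S.Side) : S.IsSide g.1 g.2.1 :=
  Or.inr ⟨by omega, by exact_mod_cast g.2.2⟩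

theorem shift_zero (g : S.Side) : S.shift g 0 = g := by
  rw [shift, add_zero, sideAt_self]

theorem shift_sideAt (Δ : S.Poly) (i d : ℤ) : S.shift (S.sideAt Δ i) d = S.sideAt Δ (i + d) := by
  refine sideAt_congr ?_
  rw [coe_sideAt]
  exact (Int.mod_modEq _ _).add_right d

theorem shift_shift (g : S.Side) (d e : ℤ) : S.shift (S.shift g d) e = S.shift g (d + e) := by
  rw [show S.shift g (d + e) = S.sideAt g.1 (g.2.1 + d + e) by rw [shift, add_assoc]]
  exact shift_sideAt _ _ _

/-- The side `i` runs from the vertex `i` to the vertex `i + 1`; a disc has more vertices than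
sides, so the second end needs no reduction. -/
theorem IsSide.isVertex {Δ : S.Poly} {i e : ℤ} (h : S.IsSide Δ i) (he : e = 0 ∨ e = 1) :
    S.IsVertex Δ (i + e) := by
  by_cases hh : S.holed Δ = true
  · exact Or.inl hh
  · have h1 := n_lt_numVert (Bool.eq_false_iff.2 hh)
    rcases h with h | h
    · exact absurd h hh
    · right; omega

end Coordinates

/-! ### Words of turns: validity, crossed sides, endpoints -/

section Words

variable {S : MarkedRibbonSurface}

theorem valid_cons (Δ : S.Poly) (i d : ℤ) {l : List ℤ} (hl : l ≠ []) :
    S.Valid Δ i (d :: l) ↔ S.IsSide Δ (i + d) ∧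
      S.Valid (S.glue (S.sideAt Δ (i + d))).1 (S.glue (S.sideAt Δ (i + d))).2.1 l := by
  cases l with
  | nil => exact absurd rfl hl
  | cons => rfl

theorem exitsFrom_cons (Δ : S.Poly) (i d : ℤ) {l : List ℤ} (hl : l ≠ []) :
    S.exitsFrom Δ i (d :: l) = S.sideAt Δ (i + d) ::
      S.exitsFrom (S.glue (S.sideAt Δ (i + d))).1 (S.glue (S.sideAt Δ (i + d))).2.1 l := by
  cases l with
  | nil => exact absurd rfl hl
  | cons => rfl

theorem endFrom_cons (Δ : S.Poly) (i d : ℤ) {l : List ℤ} (hl : l ≠ []) :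
    S.endFrom Δ i (d :: l) =
      S.endFrom (S.glue (S.sideAt Δ (i + d))).1 (S.glue (S.sideAt Δ (i + d))).2.1 l := by
  cases l with
  | nil => exact absurd rfl hl
  | cons => rfl

theorem valid_congr {Δ : S.Poly} {i j d e : ℤ} {l : List ℤ} (h : S.SameCoord Δ (i + d) (j + e)) :
    S.Valid Δ i (d :: l) ↔ S.Valid Δ j (e :: l) := by
  cases l with
  | nil => exact isVertex_congr h
  | cons => rw [Valid, Valid, isSide_congr h, sideAt_congr h.modEq]

theorem endFrom_congr {Δ : S.Poly} {i j d e : ℤ} {l : List ℤ} (h : S.SameCoord Δ (i + d) (j + e)) :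
    S.endFrom Δ i (d :: l) = S.endFrom Δ j (e :: l) := by
  cases l with
  | nil => exact vertexAt_congr h
  | cons => rw [endFrom, endFrom, sideAt_congr h.modEq]

theorem Valid.ne_nil {Δ : S.Poly} {i : ℤ} {l : List ℤ} (h : S.Valid Δ i l) : l ≠ [] := by
  rintro rfl
  exact h

/-- If the continuations `m`, `m'` of `l` are equally valid and have the same endpoint in every
possible position, then the same holds for `l ++ m` and `l ++ m'`. -/
theorem append_congr {l m m' : List ℤ} (hm : m ≠ []) (hm' : m' ≠ [])
    (h : ∀ Δ i, S.Valid Δ i m → S.Valid Δ i m' ∧ S.endFrom Δ i m = S.endFrom Δ i m') (Δ : S.Poly) (i : ℤ)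
    (hv : S.Valid Δ i (l ++ m)) :
    S.Valid Δ i (l ++ m') ∧ S.endFrom Δ i (l ++ m) = S.endFrom Δ i (l ++ m') := by
  induction l generalizing Δ i with
  | nil => exact h Δ i hv
  | cons d l ih =>
    have hn : l ++ m ≠ [] := by simp [hm]
    have hn' : l ++ m' ≠ [] := by simp [hm']
    rw [List.cons_append, valid_cons _ _ _ hn] at hv
    obtain ⟨h1, h2⟩ := ih _ _ hv.2
    exact ⟨(valid_cons _ _ _ hn').2 ⟨hv.1, h1⟩,
      (endFrom_cons _ _ _ hn).trans (h2.trans (endFrom_cons _ _ _ hn').symm)⟩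

/-- After a turn `0` the curve is back in the old polygon, at the side it had left, by `glue_glue`;
the turns `a` and `b` then add up. The end vertex is literally unchanged, which fails for the other
two moves. -/
theorem spur_congr {l l' : List ℤ} {a b : ℤ} (Δ : S.Poly) (i : ℤ)
    (hv : S.Valid Δ i (l ++ a :: 0 :: b :: l')) :
    S.Valid Δ i (l ++ (a + b) :: l') ∧
      S.endFrom Δ i (l ++ a :: 0 :: b :: l') = S.endFrom Δ i (l ++ (a + b) :: l') := by
  refine append_congr (by simp) (by simp) (fun Δ i h => ?_) Δ i hv
  rw [Valid, Valid, add_zero, sideAt_self, S.glue_glue] at h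
  rw [endFrom, endFrom, add_zero, sideAt_self, S.glue_glue]
  have hs : S.SameCoord Δ ((S.sideAt Δ (i + a)).2.1 + b) (i + (a + b)) := by
    rw [← add_assoc]; exact (sameCoord_sideAt h.1).add b
  exact ⟨(valid_congr hs).1 h.2.2, endFrom_congr hs⟩

/-- The new curve ends one polygon earlier. The gluing reverses sides, so the end `e` of one copy of
the arc is the end `1 - e` of the other. -/
theorem last_valid {l : List ℤ} {a e : ℤ} (he : e = 0 ∨ e = 1) (Δ : S.Poly) (i : ℤ)
    (hv : S.Valid Δ i (l ++ [a, e])) : S.Valid Δ i (l ++ [a + (1 - e)]) := by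
  induction l generalizing Δ i with
  | nil =>
    have := IsSide.isVertex (e := 1 - e) hv.1 (by omega)
    rwa [add_assoc] at this
  | cons d l ih =>
    rw [List.cons_append, valid_cons _ _ _ (by simp)] at hv ⊢
    exact ⟨hv.1, ih _ _ hv.2⟩

/-- The removed crossing is with the side `i + d`, which has the vertex `i` as its end `-d`; in the
glued copy this is the end `1 + d`. -/
theorem first_coord {Δ : S.Poly} {i d : ℤ} (hd : d = 0 ∨ d = -1) :
    S.SameCoord (S.glue (S.sideAt Δ (i + d))).1
      (S.vertexAt (S.glue (S.sideAt Δ (i + d))).1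
        ((S.glue (S.sideAt Δ (i + d))).2.1 + (1 + d))).2.1
      ((S.glue (S.sideAt Δ (i + d))).2.1 + (1 + d)) :=
  sameCoord_vertexAt (IsSide.isVertex (isSide_self _) (by omega))

theorem first_valid {l : List ℤ} {b d : ℤ} (hd : d = 0 ∨ d = -1) (Δ : S.Poly) (i : ℤ)
    (hv : S.Valid Δ i (d :: b :: l)) :
    S.Valid (S.vertexAt (S.glue (S.sideAt Δ (i + d))).1
        ((S.glue (S.sideAt Δ (i + d))).2.1 + (1 + d))).1
      (S.vertexAt (S.glue (S.sideAt Δ (i + d))).1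
        ((S.glue (S.sideAt Δ (i + d))).2.1 + (1 + d))).2.1
      ((b - (1 + d)) :: l) := by
  have h := (first_coord (S := S) (Δ := Δ) (i := i) hd).add (b - (1 + d))
  rw [add_add_sub_cancel] at h
  exact (valid_congr (l := l) h).2 hv.2

theorem length_exitsFrom (Δ : S.Poly) (i : ℤ) (l : List ℤ) :
    (S.exitsFrom Δ i l).length = l.length - 1 := by
  induction l generalizing Δ i with
  | nil => rfl
  | cons d l ih =>
    cases l with
    | nil => rfl
    | cons d' l => simp [exitsFrom, ih]

theorem exitsFrom_zero (Δ : S.Poly) (i : ℤ) {d : ℤ} {l : List ℤ} (h0 : l[0]? = some d)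
    (hl : 1 < l.length) : (S.exitsFrom Δ i l)[0]? = some (S.sideAt Δ (i + d)) := by
  match l, hl with
  | d' :: d'' :: l, _ => simp_all [exitsFrom]

/-- The exits satisfy a local recursion, so one common exit and equal later turns determine the
rest. This is what allows parts of different curves to be compared. -/
theorem exitsFrom_succ (Δ : S.Poly) (i : ℤ) {d : ℤ} {l : List ℤ} {j : ℕ} {h : S.Side}
    (hj : (S.exitsFrom Δ i l)[j]? = some h) (hd : l[j + 1]? = some d) (hl : j + 2 < l.length) :
    (S.exitsFrom Δ i l)[j + 1]? = some (S.shift (S.glue h) d) := by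
  induction l generalizing Δ i j with
  | nil => simp at hl
  | cons x l ih =>
    have hn : l ≠ [] := by rintro rfl; simp at hl
    rw [exitsFrom_cons _ _ _ hn] at hj ⊢
    cases j with
    | zero =>
      simp only [List.getElem?_cons_zero, Option.some.injEq] at hj
      subst hj
      rw [List.getElem?_cons_succ]
      exact exitsFrom_zero _ _ (by simpa using hd) (by simp at hl; omega)
    | succ j =>
      rw [List.getElem?_cons_succ] at hj hd ⊢
      exact ih _ _ hj hd (by simp at hl; omega)

theorem isSide_of_exitsFrom (Δ : S.Poly) (i : ℤ) {d : ℤ} {l : List ℤ} {j : ℕ} {h : S.Side}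
    (hv : S.Valid Δ i l) (hj : (S.exitsFrom Δ i l)[j]? = some h) (hd : l[j + 1]? = some d)
    (hl : j + 2 < l.length) : S.IsSide (S.glue h).1 ((S.glue h).2.1 + d) := by
  induction l generalizing Δ i j with
  | nil => simp at hl
  | cons x l ih =>
    have hn : l ≠ [] := by rintro rfl; simp at hl
    rw [exitsFrom_cons _ _ _ hn] at hj
    rw [valid_cons _ _ _ hn] at hv
    cases j with
    | zero =>
      simp only [List.getElem?_cons_zero, Option.some.injEq] at hj
      subst hj
      match l, hl with
      | y :: z :: l, _ =>
        simp only [zero_add, List.getElem?_cons_succ, List.getElem?_cons_zero,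
          Option.some.injEq] at hd
        subst hd
        exact hv.2.1
    | succ j =>
      rw [List.getElem?_cons_succ] at hj hd
      exact ih _ _ hv.2 hj hd (by simp at hl; omega)

theorem endFrom_eq (Δ : S.Poly) (i : ℤ) {e : ℤ} {l : List ℤ} {j : ℕ} {h : S.Side}
    (hv : S.Valid Δ i l) (hj : (S.exitsFrom Δ i l)[j]? = some h) (he : l[j + 1]? = some e)
    (hl : l.length = j + 2) : S.endFrom Δ i l = S.vertexAt (S.glue h).1 ((S.glue h).2.1 + e) ∧
      S.IsVertex (S.glue h).1 ((S.glue h).2.1 + e) := by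
  induction l generalizing Δ i j with
  | nil => simp at hl
  | cons x l ih =>
    have hn : l ≠ [] := by rintro rfl; simp at hl
    rw [exitsFrom_cons _ _ _ hn] at hj
    rw [valid_cons _ _ _ hn] at hv
    rw [endFrom_cons _ _ _ hn]
    cases j with
    | zero =>
      simp only [List.getElem?_cons_zero, Option.some.injEq] at hj
      subst hj
      match l, hl with
      | [y], _ =>
        simp only [zero_add, List.getElem?_cons_succ, List.getElem?_cons_zero,
          Option.some.injEq] at he
        subst he
        exact ⟨rfl, hv.2⟩
    | succ j =>
      rw [List.getElem?_cons_succ] at hj he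
      exact ih _ _ hv.2 hj he (by simp at hl; omega)

/-- Two curves that cross a common side and then turn in the same way cross the same sides. -/
theorem exitsFrom_agree {Δ Δ' : S.Poly} {i i' : ℤ} {l l' : List ℤ} {a b : ℕ}
    (h0 : (S.exitsFrom Δ i l)[a]? = (S.exitsFrom Δ' i' l')[b]?) {m : ℕ} (hl : a + m + 1 < l.length)
    (hl' : b + m + 1 < l'.length)
    (ht : ∀ j < m, l[a + 1 + j]? = l'[b + 1 + j]?) :
    (S.exitsFrom Δ i l)[a + m]? = (S.exitsFrom Δ' i' l')[b + m]? := by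
  induction m with
  | zero => exact h0
  | succ m ih =>
    have h := ih (by omega) (by omega) fun j hj => ht j (by omega)
    have hg : a + m < (S.exitsFrom Δ i l).length := by rw [length_exitsFrom]; omega
    rw [List.getElem?_eq_getElem hg] at h
    have ht' := ht m (by omega)
    rw [show a + 1 + m = a + m + 1 by omega, show b + 1 + m = b + m + 1 by omega,
      List.getElem?_eq_getElem (show a + m + 1 < l.length by omega)] at ht'
    rw [← add_assoc, ← add_assoc, exitsFrom_succ _ _ (List.getElem?_eq_getElem hg)
      (List.getElem?_eq_getElem (show a + m + 1 < l.length by omega)) (by omega),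
      exitsFrom_succ _ _ h.symm ht'.symm (by omega)]

end Words

/-! ### Reversed curves -/

section Reversal

variable {S : MarkedRibbonSurface}

theorem length_revTurns (l : List ℤ) : (revTurns l).length = l.length := by simp [revTurns]

theorem getElem?_revTurns {l : List ℤ} {j j' : ℕ} (h : j + j' + 1 = l.length) :
    (revTurns l)[j]? = l[j']?.map fun d => -d := by
  rw [revTurns, List.getElem?_reverse (by simp; omega), List.getElem?_map, List.length_map,
    show l.length - 1 - j = j' by omega]

theorem revTurns_revTurns (l : List ℤ) : revTurns (revTurns l) = l := by
  simp [revTurns]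

theorem revTurns_append (l m : List ℤ) : revTurns (l ++ m) = revTurns m ++ revTurns l := by
  simp [revTurns]

theorem revTurns_cons (d : ℤ) (l : List ℤ) : revTurns (d :: l) = revTurns l ++ [-d] := by
  simp [revTurns]

namespace Curve

variable (c : S.Curve)

theorem length_exits : c.exits.length = c.turns.length - 1 := length_exitsFrom _ _ _

theorem turns_ne_nil : c.turns ≠ [] := c.valid.ne_nil

theorem length_pos : 0 < c.turns.length := List.length_pos_of_ne_nil c.turns_ne_nil

/-- The exits of a word that starts as the reverse of `c`. -/
theorem exitsFrom_reverse {l : List ℤ} {p : ℕ} (hp : p + 1 < l.length)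
    (hl : ∀ j ≤ p, l[j]? = (revTurns c.turns)[j]?) {q : ℕ} (hq : p + q + 2 = c.turns.length) :
    (S.exitsFrom c.finish.1 c.finish.2.1 l)[p]? = c.exits[q]?.map S.glue := by
  induction p generalizing q with
  | zero =>
    have h0 := hl 0 le_rfl
    have hN : q < c.exits.length := by rw [length_exits]; omega
    have hT : q + 1 < c.turns.length := by omega
    rw [getElem?_revTurns (show 0 + (q + 1) + 1 = c.turns.length by omega),
      List.getElem?_eq_getElem hT] at h0
    have he := endFrom_eq _ _ c.valid (List.getElem?_eq_getElem hN) (List.getElem?_eq_getElem hT)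
      (by omega)
    rw [exitsFrom_zero _ _ h0 hp, List.getElem?_eq_getElem hN, Option.map_some]
    -- Undoing the last turn from the final vertex leads to the side through which the last polygon
    -- was entered.
    have hs := ((sameCoord_vertexAt he.2).add (-c.turns[q + 1])).modEq
    rw [add_neg_cancel_right] at hs
    rw [Curve.finish, he.1]
    refine congrArg some ((sideAt_congr hs).trans (sideAt_self _))
  | succ p ih =>
    have h := ih (by omega) (fun j hj => hl j (by omega)) (show p + (q + 1) + 2 = _ by omega)
    have hN : q < c.exits.length := by rw [length_exits]; omega
    have hT : q + 1 < c.turns.length := by omega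
    rw [Curve.exits, exitsFrom_succ _ _ (List.getElem?_eq_getElem hN) (List.getElem?_eq_getElem hT)
      (by omega), Option.map_some] at h
    have h0 := hl (p + 1) le_rfl
    rw [getElem?_revTurns (show p + 1 + (q + 1) + 1 = c.turns.length by omega),
      List.getElem?_eq_getElem hT] at h0
    -- A turn followed by its negative cancels inside the polygon.
    rw [exitsFrom_succ _ _ h h0 hp, S.glue_glue, shift_shift, add_neg_cancel, shift_zero,
      List.getElem?_eq_getElem hN, Option.map_some]

end Curve

end Reversal

end MarkedRibbonSurface

namespace MarkedRibbonSurface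

/-! ### Confluence of the homotopy moves and uniqueness of reduced curves -/

section Homotopy

variable {S : MarkedRibbonSurface}

theorem vertexAt_self (v : S.Vertex) : S.vertexAt v.1 v.2.1 = v := by
  obtain ⟨Δ, i, hi⟩ := v
  have : ((i : ℤ) % (S.numVert Δ : ℤ)) = i := Int.emod_eq_of_lt (by omega) (by exact_mod_cast hi)
  simp [vertexAt, this]

namespace Curve

theorem eq_of_start_turns {c c' : S.Curve} (h : c.start = c'.start) (h' : c.turns = c'.turns) :
    c = c' := by
  cases c; cases c'; cases h; cases h'; rfl

theorem Move.length_lt {c c' : S.Curve} (h : Move c c') : c'.turns.length < c.turns.length := by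
  cases h <;> simp_all

/-- Every move removes at least one crossing. -/
theorem IsMinimal.not_move {c : S.Curve} (hc : c.IsMinimal) (c' : S.Curve) : ¬ Move c c' :=
  fun h => absurd (hc c' (.rel _ _ h)) (not_le.2 h.length_lt)

/-- An elementary homotopy leads from `c` to a curve with the given starting point and turns. -/
def RedTo (c : S.Curve) (v : S.Vertex) (t : List ℤ) : Prop :=
  ∃ c', Move c c' ∧ c'.start = v ∧ c'.turns = t

theorem redTo_spur {c : S.Curve} {l l' : List ℤ} {a b : ℤ} (h : c.turns = l ++ a :: 0 :: b :: l') :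
    RedTo c c.start (l ++ (a + b) :: l') := by
  have hv := c.valid
  rw [h] at hv
  exact ⟨⟨c.start, _, (spur_congr _ _ hv).1⟩, .spur rfl h rfl, rfl, rfl⟩

theorem redTo_last {c : S.Curve} {l : List ℤ} {a e : ℤ} (he : e = 0 ∨ e = 1)
    (h : c.turns = l ++ [a, e]) : RedTo c c.start (l ++ [a + (1 - e)]) := by
  have hv := c.valid
  rw [h] at hv
  exact ⟨⟨c.start, _, last_valid he _ _ hv⟩, .last rfl he h rfl, rfl, rfl⟩

/-- The other representative of the starting point of a curve that starts at an end of the first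
side which it crosses. -/
def firstVertex (v : S.Vertex) (d : ℤ) : S.Vertex :=
  S.vertexAt (S.glue (S.sideAt v.1 (v.2.1 + d))).1
    ((S.glue (S.sideAt v.1 (v.2.1 + d))).2.1 + (1 + d))

theorem redTo_first {c : S.Curve} {l : List ℤ} {d b : ℤ} (hd : d = 0 ∨ d = -1)
    (h : c.turns = d :: b :: l) : RedTo c (firstVertex c.start d) ((b - (1 + d)) :: l) := by
  have hv := c.valid
  rw [h] at hv
  exact ⟨⟨_, _, first_valid hd _ _ hv⟩, .first hd h rfl rfl, rfl, rfl⟩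

/-- Passing to the neighbouring polygon and back through the same arc; the map `d ↦ -(1 + d)`
exchanges `0` and `-1`. -/
theorem firstVertex_firstVertex {v : S.Vertex} {d : ℤ} (hd : d = 0 ∨ d = -1)
    (hs : S.IsSide v.1 (v.2.1 + d)) : firstVertex (firstVertex v d) (-(1 + d)) = v := by
  have h1 : S.sideAt (firstVertex v d).1 ((firstVertex v d).2.1 + -(1 + d)) =
      S.glue (S.sideAt v.1 (v.2.1 + d)) := by
    have h := (first_coord (S := S) (Δ := v.1) (i := v.2.1) hd).add (-(1 + d))
    rw [add_neg_cancel_right] at h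
    exact (sideAt_congr h.modEq).trans (sideAt_self _)
  rw [firstVertex, h1, S.glue_glue]
  have h2 := (sameCoord_sideAt hs).add (1 + -(1 + d))
  rw [show (v.2.1 : ℤ) + d + (1 + -(1 + d)) = v.2.1 by ring] at h2
  exact (vertexAt_congr h2).trans (vertexAt_self v)

/-- Elementary homotopies, where the trivial curves are identified. -/
inductive Step : Option S.Curve → Option S.Curve → Prop
  | move {c c' : S.Curve} : Move c c' → Step (some c) (some c')
  | trivial {c : S.Curve} : c.turns.length = 1 → Step (some c) none

/-- At most one step leads from `x` and from `y` to a common result. -/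
def Joins (x y : Option S.Curve) : Prop :=
  ∃ z, Relation.ReflGen Step x z ∧ Relation.ReflGen Step y z

theorem Joins.symm {x y : Option S.Curve} (h : Joins x y) : Joins y x :=
  let ⟨z, h1, h2⟩ := h; ⟨z, h2, h1⟩

theorem joins_of_eq {b c : S.Curve} (h : b.start = c.start) (h' : b.turns = c.turns) :
    Joins (some b) (some c) := by
  rw [eq_of_start_turns h h']
  exact ⟨_, .refl, .refl⟩

theorem joins_of_redTo {b c : S.Curve} {v : S.Vertex} {t : List ℤ} (hb : RedTo b v t)
    (hc : RedTo c v t) : Joins (some b) (some c) := by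
  obtain ⟨b', hb, rfl, rfl⟩ := hb
  obtain ⟨c', hc, h, h'⟩ := hc
  rw [eq_of_start_turns h h'] at hc
  exact ⟨some b', .single (.move hb), .single (.move hc)⟩

theorem joins_of_redTo_self {b c : S.Curve} (hb : RedTo b c.start c.turns) :
    Joins (some b) (some c) := by
  obtain ⟨b', hb, h, h'⟩ := hb
  rw [eq_of_start_turns h h'] at hb
  exact ⟨some c, .single (.move hb), .refl⟩

/-- The list `z` measures the offset of the two spurs. For offset 0 or 1 the results coincide, for
offset 2 the spurs share a turn and both results reduce to the sum of three turns, and for larger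
offsets the moves commute. -/
theorem joins_spur_spur {s b c : S.Curve} {l l' m m' : List ℤ} {x y x' y' : ℤ} {z : List ℤ}
    (hbs : b.start = s.start) (hcs : c.start = s.start)
    (hb : b.turns = l ++ (x + y) :: l') (hc : c.turns = m ++ (x' + y') :: m')
    (hm : m = l ++ z) (hz : x :: 0 :: y :: l' = z ++ x' :: 0 :: y' :: m') :
    Joins (some b) (some c) := by
  have hbc := hbs.trans hcs.symm
  subst hm
  match z, hz with
  | [], hz =>
    simp only [List.nil_append, List.cons.injEq, true_and] at hz
    obtain ⟨rfl, rfl, rfl⟩ := hz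
    exact joins_of_eq hbc (by rw [hb, hc]; simp)
  | [z], hz =>
    simp only [List.cons_append, List.nil_append, List.cons.injEq] at hz
    obtain ⟨rfl, rfl, rfl, rfl⟩ := hz
    exact joins_of_eq hbc (by rw [hb, hc]; simp)
  | [z, z'], hz =>
    simp only [List.cons_append, List.nil_append, List.cons.injEq] at hz
    obtain ⟨rfl, rfl, rfl, rfl⟩ := hz
    refine joins_of_redTo (v := b.start) (redTo_spur hb) ?_
    have := redTo_spur (c := c) (l := l) (a := x) (b := y + y') (l' := m') (by rw [hc]; simp)
    rwa [← add_assoc, ← hbc] at this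
  | z :: z' :: z'' :: w, hz =>
    simp only [List.cons_append, List.cons.injEq] at hz
    obtain ⟨rfl, rfl, rfl, rfl⟩ := hz
    have h1 := redTo_spur (c := b) (l := l ++ (x + y) :: w) (a := x') (b := y') (l' := m')
      (by rw [hb]; simp)
    have h2 := redTo_spur (c := c) (l := l) (a := x) (b := y) (l' := w ++ (x' + y') :: m')
      (by rw [hc]; simp)
    rw [← hbc] at h2
    exact joins_of_redTo h1 (by simpa using h2)

theorem joins_spur_last {s b c : S.Curve} {l l' m : List ℤ} {x y a e : ℤ}
    (hbs : b.start = s.start) (hcs : c.start = s.start) (hs : s.turns = l ++ x :: 0 :: y :: l')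
    (hs' : s.turns = m ++ [a, e]) (he : e = 0 ∨ e = 1)
    (hb : b.turns = l ++ (x + y) :: l') (hc : c.turns = m ++ [a + (1 - e)]) :
    Joins (some b) (some c) := by
  have hbc := hbs.trans hcs.symm
  rw [hs] at hs'
  rcases List.eq_nil_or_concat l' with rfl | ⟨l', e', rfl⟩
  · have h1 : (l ++ [x]) ++ [0, y] = m ++ [a, e] := by simpa using hs'
    obtain ⟨rfl, h2⟩ := List.append_inj' h1 rfl
    simp only [List.cons.injEq, and_true] at h2
    obtain ⟨rfl, rfl⟩ := h2
    -- Here the spur is at the very end. Removing the last crossing leaves an end turn `1 - y`,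
    -- again `0` or `1`, and a second `last` move gives the result of the spur move.
    refine (joins_of_redTo_self (b := c) ?_).symm
    have := redTo_last (c := c) (l := l) (a := x) (e := 0 + (1 - y)) (by omega) (by rw [hc]; simp)
    rw [hb, hbc]
    simpa using this
  · rcases List.eq_nil_or_concat l' with rfl | ⟨l', a', rfl⟩
    · have h1 : (l ++ [x, 0]) ++ [y, e'] = m ++ [a, e] := by simpa using hs'
      obtain ⟨rfl, h2⟩ := List.append_inj' h1 rfl
      simp only [List.cons.injEq, and_true] at h2
      obtain ⟨rfl, rfl⟩ := h2
      have h3 := redTo_last (c := b) (l := l) (a := x + y) (e := e') he (by rw [hb]; simp)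
      have h4 := redTo_spur (c := c) (l := l) (a := x) (b := y + (1 - e')) (l' := [])
        (by rw [hc]; simp)
      rw [hbc, add_assoc] at h3
      exact joins_of_redTo h3 h4
    · have h1 : (l ++ x :: 0 :: y :: l') ++ [a', e'] = m ++ [a, e] := by simpa using hs'
      obtain ⟨rfl, h2⟩ := List.append_inj' h1 rfl
      simp only [List.cons.injEq, and_true] at h2
      obtain ⟨rfl, rfl⟩ := h2
      have h3 := redTo_last (c := b) (l := l ++ (x + y) :: l') (a := a') (e := e') he
        (by rw [hb]; simp)
      have h4 := redTo_spur (c := c) (l := l) (a := x) (b := y) (l' := l' ++ [a' + (1 - e')])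
        (by rw [hc]; simp)
      rw [hbc] at h3
      exact joins_of_redTo h3 (by simpa using h4)

theorem joins_spur_first {s b c : S.Curve} {l l' m : List ℤ} {x y d f : ℤ}
    (hbs : b.start = s.start) (hcs : c.start = firstVertex s.start d)
    (hs : s.turns = l ++ x :: 0 :: y :: l') (hs' : s.turns = d :: f :: m) (hd : d = 0 ∨ d = -1)
    (hb : b.turns = l ++ (x + y) :: l') (hc : c.turns = (f - (1 + d)) :: m) :
    Joins (some b) (some c) := by
  have hv := s.valid
  rw [hs'] at hv
  rw [hs] at hs'
  match l, hs' with
  | [], hs' =>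
    simp only [List.nil_append, List.cons.injEq] at hs'
    obtain ⟨rfl, rfl, rfl⟩ := hs'
    -- A spur at the very start: a second `first` move crosses back and restores the starting
    -- vertex.
    refine (joins_of_redTo_self (b := c) ?_).symm
    have := redTo_first (c := c) (d := -(1 + x)) (b := y) (l := l') (by omega) (by rw [hc]; simp)
    rw [hcs, firstVertex_firstVertex hd hv.1] at this
    rw [hb, hbs]
    simpa [add_comm x y] using this
  | [z], hs' =>
    simp only [List.cons_append, List.nil_append, List.cons.injEq] at hs'
    obtain ⟨rfl, rfl, rfl⟩ := hs'
    have h1 := redTo_first (c := b) (b := x + y) (l := l') hd (by rw [hb]; simp)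
    have h2 := redTo_spur (c := c) (l := []) (a := x - (1 + z)) (b := y) (l' := l')
      (by rw [hc]; simp)
    rw [hbs] at h1
    rw [hcs] at h2
    exact joins_of_redTo h1 (by simpa [show x - (1 + z) + y = x + y - (1 + z) by ring] using h2)
  | z :: z' :: w, hs' =>
    simp only [List.cons_append, List.cons.injEq] at hs'
    obtain ⟨rfl, rfl, rfl⟩ := hs'
    have h1 := redTo_first (c := b) (b := z') (l := w ++ (x + y) :: l') hd (by rw [hb]; simp)
    have h2 := redTo_spur (c := c) (l := (z' - (1 + z)) :: w) (a := x) (b := y) (l' := l')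
      (by rw [hc]; simp)
    rw [hbs] at h1
    rw [hcs] at h2
    exact joins_of_redTo h1 (by simpa using h2)

theorem joins_last_first {s b c : S.Curve} {l m : List ℤ} {a e d f : ℤ}
    (hbs : b.start = s.start) (hcs : c.start = firstVertex s.start d)
    (hs : s.turns = l ++ [a, e]) (he : e = 0 ∨ e = 1) (hs' : s.turns = d :: f :: m)
    (hd : d = 0 ∨ d = -1) (hb : b.turns = l ++ [a + (1 - e)])
    (hc : c.turns = (f - (1 + d)) :: m) : Joins (some b) (some c) := by
  rw [hs] at hs'
  match l, hs' with
  | [], hs' =>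
    simp only [List.nil_append, List.cons.injEq] at hs'
    obtain ⟨rfl, rfl, rfl⟩ := hs'
    -- With a single crossing, the two moves give trivial curves described in the two polygons
    -- adjacent to the arc. No move connects them; this is why `Step` sends trivial curves to
    -- `none`.
    exact ⟨none, .single (.trivial (by simp [hb])), .single (.trivial (by simp [hc]))⟩
  | [z], hs' =>
    simp only [List.cons_append, List.nil_append, List.cons.injEq] at hs'
    obtain ⟨rfl, rfl, rfl⟩ := hs'
    have h1 := redTo_first (c := b) (b := a + (1 - e)) (l := []) hd (by rw [hb]; simp)
    have h2 := redTo_last (c := c) (l := []) (a := a - (1 + z)) he (by rw [hc]; simp)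
    rw [hbs] at h1
    rw [hcs] at h2
    exact joins_of_redTo h1
      (by simpa [show a - (1 + z) + (1 - e) = a + (1 - e) - (1 + z) by ring] using h2)
  | z :: z' :: w, hs' =>
    simp only [List.cons_append, List.cons.injEq] at hs'
    obtain ⟨rfl, rfl, rfl⟩ := hs'
    have h1 := redTo_first (c := b) (b := z') (l := w ++ [a + (1 - e)]) hd (by rw [hb]; simp)
    have h2 := redTo_last (c := c) (l := (z' - (1 + z)) :: w) (a := a) he (by rw [hc]; simp)
    rw [hbs] at h1
    rw [hcs] at h2
    exact joins_of_redTo h1 (by simpa using h2)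

theorem joins_of_move {s b c : S.Curve} (hb : Move s b) (hc : Move s c) :
    Joins (some b) (some c) := by
  cases hb with
  | spur hbs hs hb =>
    cases hc with
    | spur hcs hs' hc =>
      rw [hs] at hs'
      rcases List.append_eq_append_iff.1 hs' with ⟨z, h1, h2⟩ | ⟨z, h1, h2⟩
      · exact joins_spur_spur hbs hcs hb hc h1 h2
      · exact (joins_spur_spur hcs hbs hc hb h1 h2).symm
    | last hcs he hs' hc => exact joins_spur_last hbs hcs hs hs' he hb hc
    | first hd hs' hc hcs => exact joins_spur_first hbs hcs hs hs' hd hb hc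
  | last hbs he hs hb =>
    cases hc with
    | spur hcs hs' hc => exact (joins_spur_last hcs hbs hs' hs he hc hb).symm
    | last hcs he' hs' hc =>
      rw [hs] at hs'
      obtain ⟨rfl, h2⟩ := List.append_inj' hs' rfl
      simp only [List.cons.injEq, and_true] at h2
      obtain ⟨rfl, rfl⟩ := h2
      exact joins_of_eq (hbs.trans hcs.symm) (hb.trans hc.symm)
    | first hd hs' hc hcs => exact joins_last_first hbs hcs hs he hs' hd hb hc
  | first hd hs hb hbs =>
    cases hc with
    | spur hcs hs' hc => exact (joins_spur_first hcs hbs hs' hs hd hc hb).symm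
    | last hcs he hs' hc => exact (joins_last_first hcs hbs hs' he hs hd hc hb).symm
    | first hd' hs' hc hcs =>
      rw [hs] at hs'
      simp only [List.cons.injEq] at hs'
      obtain ⟨rfl, rfl, rfl⟩ := hs'
      exact joins_of_eq (hbs.trans hcs.symm) (hb.trans hc.symm)

theorem Step.joins {x y z : Option S.Curve} (hy : Step x y) (hz : Step x z) : Joins y z := by
  cases hy with
  | move hy =>
    cases hz with
    | move hz => exact joins_of_move hy hz
    | trivial hz => exact absurd hy.length_lt (by have := length_pos ‹_›; omega)
  | trivial hy =>
    cases hz with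
    | move hz => exact absurd hz.length_lt (by have := length_pos ‹_›; omega)
    | trivial hz => exact ⟨none, .refl, .refl⟩

/-- Church–Rosser: the diamond property of `Step` makes joinability an equivalence relation, and it
contains the moves. -/
theorem Homotopic.join {c c' : S.Curve} (h : Homotopic c c') :
    Relation.Join (Relation.ReflTransGen Step) (some c) (some c') := by
  have he : Equivalence (Relation.Join (Relation.ReflTransGen (Step (S := S)))) :=
    Relation.equivalence_join_reflTransGen fun a b c hb hc => by
      obtain ⟨d, h1, h2⟩ := hb.joins hc
      exact ⟨d, h1, h2.to_reflTransGen⟩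
  induction h with
  | rel x y h => exact ⟨some y, .single (.move h), .refl⟩
  | refl x => exact he.refl _
  | symm x y _ ih => exact he.symm ih
  | trans x y z _ _ ih ih' => exact he.trans ih ih'

/-- Homotopic curves that are not trivial and cannot be reduced any further are equal. -/
theorem Homotopic.eq_of_irreducible {c c' : S.Curve} (h : Homotopic c c') (hc : ∀ x, ¬ Move c x)
    (hc' : ∀ x, ¬ Move c' x) (hl : c.turns.length ≠ 1) : c' = c := by
  obtain ⟨z, h1, h2⟩ := h.join
  have hz : z = some c := by
    rcases Relation.ReflTransGen.cases_head h1 with h | ⟨y, h, -⟩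
    · exact h.symm
    · cases h with
      | move h => exact absurd h (hc _)
      | trivial h => exact absurd h hl
  subst hz
  rcases Relation.ReflTransGen.cases_head h2 with h | ⟨y, h, hy⟩
  · exact Option.some.inj h
  · cases h with
    | move h => exact absurd h (hc' _)
    | trivial h =>
      rcases Relation.ReflTransGen.cases_head hy with h | ⟨y, h, -⟩ <;> cases h

/-- The three conditions exclude the moves `first`, `spur` and `last` respectively: a spur needs an
inner turn `0`. -/
theorem not_move_of_forall {c : S.Curve} {d : ℤ} {l : List ℤ} {e : ℤ}
    (hc : c.turns = d :: l ++ [e]) (hd : d ≠ 0 ∧ d ≠ -1) (hl : ∀ x ∈ l, x ≠ 0)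
    (he : e ≠ 0 ∧ e ≠ 1) (c' : S.Curve) : ¬ Move c c' := by
  intro h
  cases h with
  | @spur l₁ l₂ a b _ h _ =>
    rw [h] at hc
    rcases List.eq_nil_or_concat (b :: l₂) with h0 | ⟨l₃, e', h0⟩
    · simp at h0
    · match l₁, hc with
      | [], hc =>
        rw [h0] at hc
        simp only [List.nil_append, List.cons_append, List.cons.injEq] at hc
        have : (0 :: l₃) ++ [e'] = l ++ [e] := by simpa using hc.2
        obtain ⟨rfl, -⟩ := List.append_inj' this rfl
        exact hl 0 (by simp) rfl
      | y :: l₁, hc =>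
        rw [h0] at hc
        have : (l₁ ++ a :: 0 :: l₃) ++ [e'] = l ++ [e] := by
          simpa using (List.cons.inj (by simpa using hc)).2
        obtain ⟨rfl, -⟩ := List.append_inj' this rfl
        exact hl 0 (by simp) rfl
  | @last l₁ a e' _ he' h _ =>
    rw [h] at hc
    have : (l₁ ++ [a]) ++ [e'] = (d :: l) ++ [e] := by simpa using hc
    obtain ⟨-, h1⟩ := List.append_inj' this rfl
    simp only [List.cons.injEq, and_true] at h1
    omega
  | @first l₁ d' b hd' h _ _ =>
    rw [h] at hc
    simp only [List.cons_append, List.cons.injEq] at hc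
    omega

end Curve

end Homotopy

end MarkedRibbonSurface

namespace MarkedRibbonSurface

/-! ### Strings of curves; invariance under equivalence -/

section Strings

open BoundQuiver

variable {S : MarkedRibbonSurface}

theorem getElem?_lettersFrom (l : List ℤ) : ∀ (g : S.Side) (hv : S.Valid g.1 g.2.1 l)
    (hm : ∀ d ∈ l.dropLast, d = 1 ∨ d = -1) (p : ℕ) (a : S.Arrow × Bool),
    (S.lettersFrom g l hv hm)[p]? = some a ↔ p + 1 < l.length ∧
      ∃ h, (g :: (S.exitsFrom g.1 g.2.1 l).map S.glue)[p]? = some h ∧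
        (l[p]? = some 1 ∧ a.1.1 = h ∧ a.2 = true ∨
          l[p]? = some (-1) ∧ a.1.1 = S.shift h (-1) ∧ a.2 = false) := by
  induction l with
  | nil => intro g hv; exact hv.elim
  | cons d l ih =>
    intro g hv hm p a
    match l, hv, hm, ih with
    | [], _, _, _ => simp [lettersFrom]
    | d' :: l, hv, hm, ih =>
      rw [lettersFrom, exitsFrom_cons _ _ _ (by simp)]
      cases p with
      | zero =>
        rcases a with ⟨⟨a, ha⟩, b⟩
        by_cases hd : d = 1
        · subst hd
          simp [Prod.ext_iff, eq_comm]
        · obtain rfl : d = -1 := (hm d (by simp)).resolve_left hd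
          simp [Prod.ext_iff, eq_comm]
      | succ p =>
        rw [List.getElem?_cons_succ]
        refine (ih _ _ _ _ _).trans ?_
        simp only [List.length_cons, List.getElem?_cons_succ, List.map_cons]
        refine and_congr_left fun _ => ?_
        omega

variable (c : S.Perm)

theorem size_string : size c.string = c.1.turns.length - 1 := by
  obtain ⟨⟨v, t, hv⟩, hp⟩ := c
  match t, hv, hp with
  | [], hv, _ => exact hv.elim
  | [_], _, _ => rfl
  | d :: d' :: l, hv, hp =>
    have h1 : ∀ (l : List ℤ) (g : S.Side) (hv : S.Valid g.1 g.2.1 l)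
        (hm : ∀ d ∈ l.dropLast, d = 1 ∨ d = -1),
        (S.lettersFrom g l hv hm).length + 1 = l.length := by
      intro l
      induction l with
      | nil => intro g hv; exact hv.elim
      | cons d l ih =>
        intro g hv hm
        match l, hv, hm, ih with
        | [], _, _, _ => simp [lettersFrom]
        | d' :: l, hv, hm, ih => exact congrArg (· + 1) (ih _ _ _)
    exact h1 _ _ _ _

/-- The arrow `α` belongs to the middle segment of `c` after the crossing `p`, which has turn `d`. -/
def HasLetter (c : S.Curve) (α : S.Arrow) (p : ℕ) (d : ℤ) : Prop :=
  p + 2 < c.turns.length ∧ c.turns[p + 1]? = some d ∧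
    ∃ h, c.exits[p]? = some h ∧ α.1 = if d = 1 then S.glue h else S.shift (S.glue h) (-1)

/-- The string is described by the exits and turns of `c` alone, without the recursion and proof
arguments of `lettersFrom`; later comparisons of strings use only this and `atVertex_string`. -/
theorem leads_string (α : S.Arrow) (p q : ℕ) : Leads α c.string p q ↔
    q = p + 1 ∧ HasLetter c.1 α p 1 ∨ p = q + 1 ∧ HasLetter c.1 α q (-1) := by
  obtain ⟨⟨v, t, hv⟩, hp⟩ := c
  match t, hv, hp with
  | [], hv, _ => exact hv.elim
  | [_], _, _ => simp [Perm.string, Leads, HasLetter]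
  | d :: d' :: l, hv, hp =>
    have hc : ∀ p : ℕ, (S.glue (S.sideAt v.1 (v.2.1 + d)) ::
        (S.exitsFrom (S.glue (S.sideAt v.1 (v.2.1 + d))).1 (S.glue (S.sideAt v.1 (v.2.1 + d))).2.1
          (d' :: l)).map S.glue)[p]? =
        (Curve.exits ⟨v, d :: d' :: l, hv⟩)[p]?.map S.glue := by
      intro p
      rw [← List.getElem?_map]
      rfl
    have hd : ((-1 : ℤ) = 1) = False := by simp
    refine or_congr (and_congr_right fun _ => ?_) (and_congr_right fun _ => ?_)
    · refine (getElem?_lettersFrom _ _ _ _ _ _).trans ?_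
      rw [HasLetter, hc]
      simp [and_left_comm]
    · refine (getElem?_lettersFrom _ _ _ _ _ _).trans ?_
      rw [HasLetter, hc]
      simp [hd, and_left_comm]

theorem atVertex_string (p : ℕ) (v : S.Arc) :
    AtVertex c.string p v ↔ ∃ h, c.1.exits[p]? = some h ∧ S.arc h = v := by
  obtain ⟨⟨w, t, hv⟩, hp⟩ := c
  match t, hv, hp with
  | [], hv, _ => exact hv.elim
  | [_], _, _ => simp [Perm.string, AtVertex, Curve.exits, exitsFrom]
  | d :: d' :: l, hv, hp =>
    have h1 : ∀ p h, (Curve.exits ⟨w, d :: d' :: l, hv⟩)[p]? = some h →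
        AtVertex (Perm.string ⟨⟨w, d :: d' :: l, hv⟩, hp⟩) p (S.arc h) := by
      intro p h hh
      have hl := (List.getElem?_eq_some_iff.1 hh).1
      rw [Curve.length_exits] at hl
      cases p with
      | zero =>
        rw [Curve.exits, exitsFrom_zero _ _ rfl (by simp), Option.some.injEq] at hh
        subst hh
        rfl
      | succ p =>
        have hlt : p < (Curve.exits ⟨w, d :: d' :: l, hv⟩).length := by
          rw [Curve.length_exits]; omega
        have hl' : p + 2 < (d :: d' :: l).length := by simp only at hl; omega
        have hlt' : p + 1 < (d :: d' :: l).length := by omega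
        have he := List.getElem?_eq_getElem hlt
        have ht := List.getElem?_eq_getElem hlt'
        have hs := exitsFrom_succ _ _ he ht hl'
        rw [Curve.exits, hs, Option.some.injEq] at hh
        subst hh
        have hn := isSide_of_exitsFrom _ _ hv he ht hl'
        have hmem : (d :: d' :: l)[p + 1] ∈ (d :: d' :: l).tail.dropLast := by
          rw [List.mem_iff_getElem]
          exact ⟨p, by simp at hl' ⊢; omega, by simp⟩
        -- The arc at the position `p + 1` is the target of the letter before it if that letter is
        -- an arrow, and the source of the arrow if the letter is inverse.
        rcases hp.middle _ hmem with h1 | h1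
        · rw [h1] at hn ht ⊢
          have := (leads_string ⟨⟨w, d :: d' :: l, hv⟩, hp⟩ ⟨_, S.hasNext_of_isSide _ hn⟩ p
            (p + 1)).2 (Or.inl ⟨rfl, hl', ht, _, he, by simp⟩)
          exact this.target
        · rw [h1] at hn ht ⊢
          have := (leads_string ⟨⟨w, d :: d' :: l, hv⟩, hp⟩ ⟨_, S.hasNext_shift_of_isSide _ hn⟩
            (p + 1) p).2 (Or.inr ⟨rfl, hl', ht, _, he, by simp⟩)
          exact this.source
    constructor
    · intro h
      have hlt : p < (Curve.exits ⟨w, d :: d' :: l, hv⟩).length := by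
        rw [Curve.length_exits]
        cases p with
        | zero => simp
        | succ p =>
          obtain ⟨a, ha, -⟩ := h
          have := ((getElem?_lettersFrom _ _ _ _ _ _).1 ha).1
          simp at this ⊢
          omega
      exact ⟨_, List.getElem?_eq_getElem hlt,
        atVertex_unique (h1 _ _ (List.getElem?_eq_getElem hlt)) h⟩
    · rintro ⟨h, hh, rfl⟩
      exact h1 p h hh

variable {c}

/-- A part of the curve `c` gives a part of its string. -/
theorem occurs_of_shift {c' : S.Perm} {a m : ℕ} (hl' : c'.1.turns.length = m + 1)
    (hl : a + m + 1 ≤ c.1.turns.length)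
    (he : ∀ p < m, c'.1.exits[p]? = c.1.exits[a + p]?)
    (ht : ∀ p, p + 1 < m → c'.1.turns[p + 1]? = c.1.turns[a + p + 1]?) :
    Occurs c'.string c.string fun q => a ≤ q ∧ q < a + m := by
  have hs : size c'.string = m := by rw [size_string]; omega
  have hs' : a + m ≤ size c.string := by rw [size_string]; omega
  have hL : ∀ α p d, p + 1 < m → (HasLetter c'.1 α p d ↔ HasLetter c.1 α (a + p) d) := by
    intro α p d hp
    rw [HasLetter, HasLetter, he p (by omega), ht p hp]
    exact and_congr_left fun _ => by omega
  refine ⟨fun p => ⟨a + p, by omega⟩, fun p q h => ?_, fun q => ?_, fun p v => ?_,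
    fun α p q => ?_⟩
  · simpa [Fin.ext_iff] using h
  · constructor
    · intro h
      exact ⟨⟨q - a, by omega⟩, Fin.ext (by simp; omega)⟩
    · rintro ⟨p, rfl⟩
      have := p.2
      exact ⟨by simp, by simp; omega⟩
  · rw [atVertex_string, atVertex_string, he p (by omega)]
  · have h1 := p.2
    have h2 := q.2
    rw [leads_string, leads_string]
    refine or_congr ?_ ?_
    · rw [show ((q : ℕ) = p + 1 ↔ a + (q : ℕ) = a + p + 1) by omega]
      exact and_congr_right fun h => hL _ _ _ (by omega)
    · rw [show ((p : ℕ) = q + 1 ↔ a + (p : ℕ) = a + q + 1) by omega]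
      exact and_congr_right fun h => hL _ _ _ (by omega)

/-- A part of the reversed curve gives a part of the string, read backwards. -/
theorem occurs_of_reverse {c' : S.Perm} {a : ℕ} (hl : c'.1.turns.length + a = c.1.turns.length)
    (he : ∀ p q, p + 1 < c'.1.turns.length → p + q + 2 = c.1.turns.length →
      c'.1.exits[p]? = c.1.exits[q]?.map S.glue)
    (ht : ∀ p q, p + 2 < c'.1.turns.length → p + q + 2 = c.1.turns.length →
      c'.1.turns[p + 1]? = c.1.turns[q]?.map fun d => -d) :
    Occurs c'.string c.string fun q => a ≤ q := by
  have hpos := c'.1.length_pos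
  have hs : size c'.string + 1 = c'.1.turns.length := by rw [size_string]; omega
  have hs' : size c.string + 1 = c.1.turns.length := by rw [size_string]; omega
  -- Reversal keeps the corner and changes the sign of the turn. The letter between `p` and `p + 1`
  -- becomes the one between `q` and `q + 1`, hence the sum `p + q + 3`.
  have hL : ∀ α p q d, (d = 1 ∨ d = -1) → p + 2 < c'.1.turns.length →
      p + q + 3 = c.1.turns.length → (HasLetter c'.1 α p d ↔ HasLetter c.1 α q (-d)) := by
    intro α p q d hd hp hq
    have hT : q + 1 < c.1.turns.length := by omega
    have hE : q < c.1.exits.length := by rw [Curve.length_exits]; omega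
    have hT' := List.getElem?_eq_getElem hT
    have hE' := List.getElem?_eq_getElem hE
    have hE'' := exitsFrom_succ _ _ hE' hT' (by omega)
    rw [HasLetter, HasLetter, ht p (q + 1) hp (by omega), he p (q + 1) (by omega) (by omega),
      show c.1.exits[q + 1]? = _ from hE'', hT', hE']
    simp only [Option.map_some, Option.some.injEq, S.glue_glue, exists_eq_left', neg_eq_iff_eq_neg]
    refine and_congr (by omega) (and_congr_right fun h => ?_)
    rw [h]
    rcases hd with rfl | rfl
    · simp
    · simp [shift_shift, shift_zero]
  refine ⟨fun p => ⟨size c.string - 1 - p, by omega⟩, fun p q h => ?_, fun q => ?_, fun p v => ?_,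
    fun α p q => ?_⟩
  · have h1 := p.2
    have h2 := q.2
    simp only [Fin.mk.injEq] at h
    exact Fin.ext (by omega)
  · have h1 := q.2
    constructor
    · intro h
      exact ⟨⟨size c.string - 1 - q, by omega⟩, Fin.ext (by simp; omega)⟩
    · rintro ⟨p, rfl⟩
      have := p.2
      simp
      omega
  · have h1 := p.2
    rw [atVertex_string, atVertex_string,
      he p (size c.string - 1 - p) (by omega) (by omega)]
    simp only [Option.map_eq_some_iff, exists_exists_and_eq_and, arc_glue]
  · have h1 := p.2
    have h2 := q.2
    rw [leads_string, leads_string, or_comm]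
    refine or_congr ?_ ?_
    · simp only
      rw [show ((p : ℕ) = q + 1 ↔ size c.string - 1 - (q : ℕ) = size c.string - 1 - p + 1) by omega]
      exact and_congr_right fun h => by
        simpa using hL α q (size c.string - 1 - p) (-1) (by simp) (by omega) (by omega)
    · simp only
      rw [show ((q : ℕ) = p + 1 ↔ size c.string - 1 - (p : ℕ) = size c.string - 1 - q + 1) by omega]
      exact and_congr_right fun h =>
        hL α p (size c.string - 1 - q) 1 (by simp) (by omega) (by omega)

theorem string_eq_none {c : S.Perm} (h : c.1.turns.length = 1) : c.string = none := by
  obtain ⟨⟨v, t, hv⟩, hp⟩ := c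
  match t, hv, hp, h with
  | [_], _, _, _ => rfl

/-- A slide changes only the last turn, which contributes no letter; a reversal reads the same
string backwards. -/
theorem ElemEquiv.occurs {c c' : S.Perm} (h : ElemEquiv c c') :
    Occurs c'.string c.string fun _ => True := by
  cases h with
  | rev hs ht =>
    have hl : c'.1.turns.length = c.1.turns.length := by rw [ht, length_revTurns]
    refine (occurs_of_reverse (a := 0) hl (fun p q hp hq => ?_) fun p q hp hq => ?_).congr (by simp)
    · rw [Curve.exits, hs]
      exact c.1.exitsFrom_reverse hp (fun j _ => by rw [ht]) hq
    · rw [ht, getElem?_revTurns (j' := q) (by omega)]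
  | @slide d e e' l hs ht ht' =>
    have hl : c'.1.turns.length = l.length + 1 + 1 := by simp [ht']
    have hl' : c.1.turns.length = l.length + 1 + 1 := by simp [ht]
    have htt : ∀ p < l.length + 1, c'.1.turns[p]? = c.1.turns[p]? := fun p hp => by
      rw [ht, ht', List.getElem?_append_left (by simpa using hp),
        List.getElem?_append_left (by simpa using hp)]
    refine (occurs_of_shift (a := 0) hl (by omega) (fun p hp => ?_) fun p hp => ?_).congr
      fun q hq => ?_
    · rw [zero_add]
      have h0 : c'.1.exits[0]? = c.1.exits[0]? := by
        have h1 : c.1.turns[0]? = some d := by simp [ht]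
        have h2 : c'.1.turns[0]? = some d := by simp [ht']
        rw [Curve.exits, Curve.exits, hs, exitsFrom_zero _ _ h1 (by omega),
          exitsFrom_zero _ _ h2 (by omega)]
      have := exitsFrom_agree h0 (m := p) (by omega) (by omega) fun j hj => by
        rw [htt _ (by omega)]
      rwa [zero_add] at this
    · rw [zero_add, htt _ (by omega)]
    · rw [size_string] at hq
      simp only [iff_true]
      omega
  | trivial h h' =>
    rw [string_eq_none h, string_eq_none h']
    exact Occurs.refl _

theorem Equiv.occurs {c c' : S.Perm} (h : Equiv c c') :
    Occurs c.string c'.string fun _ => True := by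
  induction h with
  | rel x y h => exact h.occurs.symm
  | refl x => exact Occurs.refl _
  | symm x y _ ih => exact ih.symm
  | trans x y z _ _ ih ih' => exact ih.trans ih'

end Strings

end MarkedRibbonSurface

namespace MarkedRibbonSurface

/-! ### Turns and strings of truncated and rotated curves -/

section Rotations

open BoundQuiver

variable {S : MarkedRibbonSurface}

theorem joinTurns_append_singleton (L : List ℤ) (u v : ℤ) (R : List ℤ) :
    joinTurns (L ++ [u]) (v :: R) = L ++ (u + v) :: R := by
  simp [joinTurns, List.getLastD_eq_getLast?]

theorem joinTurns_joinTurns (A : List ℤ) (s s' : ℤ) :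
    joinTurns (joinTurns A [s]) [s'] = joinTurns A [s + s'] := by
  rcases List.eq_nil_or_concat' A with rfl | ⟨L, u, rfl⟩
  · simp [joinTurns]
  · rw [joinTurns_append_singleton, joinTurns_append_singleton, joinTurns_append_singleton,
      add_assoc]

/-- Moving the final endpoint by `s` amounts to changing the first turn of the path walked
backwards. The rotated curve thus keeps the shape required by `spursTo_joinTurns`. -/
theorem joinTurns_revTurns_cons (A B : List ℤ) (hA : A ≠ []) (y s : ℤ) :
    joinTurns (joinTurns A (revTurns (y :: B))) [s] = joinTurns A (revTurns ((y - s) :: B)) := by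
  obtain ⟨L, u, rfl⟩ := (List.eq_nil_or_concat' A).resolve_left hA
  rw [revTurns_cons, revTurns_cons]
  cases revTurns B with
  | nil =>
    rw [List.nil_append, List.nil_append, joinTurns_append_singleton, joinTurns_append_singleton,
      joinTurns_append_singleton]
    congr 2; ring
  | cons r R =>
    rw [List.cons_append, List.cons_append, joinTurns_append_singleton, joinTurns_append_singleton,
      show L ++ (u + r) :: (R ++ [-y]) = (L ++ (u + r) :: R) ++ [-y] by simp,
      joinTurns_append_singleton, show -(y - s) = -y + s by ring]
    simp

namespace Curve

/-- Removing spurs leads from `c` to a curve with turns `t`. -/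
def SpursTo (c : S.Curve) (t : List ℤ) : Prop :=
  ∃ c' : S.Curve, c'.start = c.start ∧ c'.turns = t ∧ Homotopic c c' ∧ c'.finish = c.finish

/-- At the turning point the last turn `b` of the way out meets the first turn `-b` of the way back;
their sum `0` is a spur. Its removal joins the neighbouring turns and leaves the same configuration
with a shorter `B`. -/
theorem spursTo_joinTurns (P B : List ℤ) (x y : ℤ) : ∀ c : S.Curve,
    c.turns = joinTurns (P ++ x :: B) (revTurns (y :: B)) → SpursTo c (P ++ [x - y]) := by
  induction B using List.reverseRecOn with
  | nil =>
    intro c hc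
    refine ⟨c, rfl, ?_, .refl _, rfl⟩
    rw [hc]
    simp [joinTurns, revTurns, sub_eq_add_neg, List.getLastD_eq_getLast?]
  | append_singleton B b ih =>
    intro c hc
    obtain ⟨L, u, hL⟩ := (List.eq_nil_or_concat' (P ++ x :: B)).resolve_left (by simp)
    obtain ⟨v, R, hR⟩ := List.exists_cons_of_ne_nil (l := revTurns (y :: B))
      (by simp [revTurns])
    have h1 : c.turns = L ++ u :: 0 :: v :: R := by
      rw [hc, show P ++ x :: (B ++ [b]) = (P ++ x :: B) ++ [b] by simp,
        show y :: (B ++ [b]) = (y :: B) ++ [b] by simp, revTurns_append, hR]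
      rw [show revTurns [b] ++ v :: R = (-b) :: v :: R by simp [revTurns],
        joinTurns_append_singleton, hL]
      simp
    have hv := c.valid
    rw [h1] at hv
    have hs := spur_congr _ _ hv
    let c₁ : S.Curve := ⟨c.start, _, hs.1⟩
    obtain ⟨c', h2, h3, h4, h5⟩ := ih c₁ (by
      rw [hL, hR]; exact (joinTurns_append_singleton L u v R).symm)
    refine ⟨c', h2, h3, .trans _ c₁ _ (.rel _ _ (.spur rfl h1 rfl)) h4, h5.trans ?_⟩
    rw [Curve.finish, Curve.finish, h1]
    exact hs.2.symm

theorem not_move_ends {c : S.Curve} (hc : ∀ c', ¬ Move c c') {d e : ℤ} {l : List ℤ}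
    (h : c.turns = d :: l ++ [e]) : (d ≠ 0 ∧ d ≠ -1) ∧ (e ≠ 0 ∧ e ≠ 1) := by
  constructor
  · by_contra hd
    obtain ⟨b, m, hm⟩ := List.exists_cons_of_ne_nil (l := l ++ [e]) (by simp)
    obtain ⟨c', h', -⟩ := redTo_first (c := c) (d := d) (b := b) (l := m) (by tauto)
      (by rw [h, ← hm]; rfl)
    exact hc c' h'
  · by_contra he
    obtain ⟨m, a, hm⟩ := (List.eq_nil_or_concat' (d :: l)).resolve_left (by simp)
    obtain ⟨c', h', -⟩ := redTo_last (c := c) (e := e) (a := a) (l := m) (by tauto)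
      (by rw [h, hm]; simp)
    exact hc c' h'

end Curve

open Curve

/-- The turns of a rotated curve: `s` is the step by which the endpoint of `w` is moved. -/
theorem start_turns_of_rotation {w w' c : S.Curve} {P B : List ℤ} {x y s : ℤ}
    (hw : w.turns = joinTurns (P ++ x :: B) (revTurns (y :: B))) (hs : w'.start = w.start)
    (hw' : w'.turns = joinTurns w.turns [s]) (hc : Homotopic w' c) (hm : ∀ c', ¬ Move c c')
    {d : ℤ} {l : List ℤ} (hP : P = d :: l) (hd : d ≠ 0 ∧ d ≠ -1) (hl : ∀ z ∈ l, z ≠ 0)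
    (he : x - y + s ≠ 0 ∧ x - y + s ≠ 1) :
    c.start = w.start ∧ c.turns = P ++ [x - y + s] := by
  rw [hw, joinTurns_revTurns_cons _ _ (by simp)] at hw'
  obtain ⟨u, hu, hu', huw, -⟩ := spursTo_joinTurns _ _ _ _ _ hw'
  rw [show x - (y - s) = x - y + s by ring] at hu'
  have hi := not_move_of_forall (c := u) (hu'.trans (by rw [hP])) hd hl he
  have := Homotopic.eq_of_irreducible (.trans _ _ _ (.symm _ _ huw) hc) hi hm
    (by rw [hu', hP]; simp)
  rw [this, hu', hu, hs]
  exact ⟨rfl, rfl⟩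

/-- The case of an empty outer part: everything cancels. Uniqueness of irreducible curves is not
available for trivial curves, so minimality of `c` is used instead. -/
theorem length_of_trivial_rotation {w w' c : S.Curve} {B : List ℤ} {x y s : ℤ}
    (hw : w.turns = joinTurns (x :: B) (revTurns (y :: B)))
    (hw' : w'.turns = joinTurns w.turns [s]) (hc : Homotopic w' c) (hm : c.IsMinimal) :
    c.turns.length = 1 := by
  rw [hw, joinTurns_revTurns_cons _ _ (by simp)] at hw'
  obtain ⟨u, -, hu', huw, -⟩ := spursTo_joinTurns [] _ _ _ _ hw'
  have h := hm u (.trans _ _ _ (.symm _ _ hc) huw)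
  have := c.length_pos
  rw [hu'] at h
  simp at h
  omega

/-- The corner between two consecutive sides that `c` passes, seen from the reversed curve. -/
theorem isSide_reverse {c : S.Curve} {j : ℕ} {t : ℤ} {h : S.Side} (hj : c.exits[j + 1]? = some h)
    (ht : c.turns[j + 1]? = some t) : S.IsSide h.1 (h.2.1 + -t) := by
  have hl := (List.getElem?_eq_some_iff.1 hj).1
  have hl' := hl
  rw [length_exits] at hl'
  have hj' := List.getElem?_eq_getElem (show j < c.exits.length by omega)
  have hi := isSide_of_exitsFrom _ _ c.valid hj' ht (by omega)
  have he := exitsFrom_succ _ _ hj' ht (by omega)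
  rw [show S.exitsFrom _ _ _ = c.exits from rfl, hj, Option.some.injEq] at he
  subst he
  have := (sameCoord_sideAt hi).add (-t)
  rw [add_neg_cancel_right] at this
  exact (isSide_congr this).2 (isSide_self _)

/-- After a turn `d = ±1`, moving to the next vertex by `step` leaves the side `g`. -/
def LeavesSide (S : MarkedRibbonSurface) (d : ℤ) (step : S.Vertex → ℤ) : Prop :=
  ∀ g : S.Side, S.IsSide g.1 (g.2.1 + d) →
    d + truncTurn (-d) + step (S.vertexAt g.1 (g.2.1 + (d + truncTurn (-d)))) ≠ 0 ∧
    d + truncTurn (-d) + step (S.vertexAt g.1 (g.2.1 + (d + truncTurn (-d)))) ≠ 1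

theorem coe_vertexAt_of_not_holed {Δ : S.Poly} {i : ℤ} (hh : S.holed Δ = false)
    (h : S.IsVertex Δ i) : ((S.vertexAt Δ i).2.1 : ℤ) = i := by
  rcases sameCoord_vertexAt h with h | h
  · exact h
  · simp [hh] at h

/-- The truncation ends at the vertex `0` relative to `g`. The step is `-1`, or it wraps around to
`numVert - 1`; the latter is at least 2 because the polygon has a second side in `Γ`. -/
theorem leavesSide_posStep : LeavesSide S 1 S.posStep := by
  intro g hg
  have h0 : (1 : ℤ) + truncTurn (-1) = 0 := by simp [truncTurn]
  rw [h0, add_zero]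
  unfold posStep
  split_ifs with h
  · have hh : S.holed g.1 = false := h.1
    have h1 := n_lt_numVert hh
    have h2 : (0 : ℤ) ≤ g.2.1 := by omega
    rcases hg with hg | hg
    · simp [hh] at hg
    · change 0 + ((S.numVert g.1 : ℤ) - 1) ≠ 0 ∧ 0 + ((S.numVert g.1 : ℤ) - 1) ≠ 1
      omega
  · omega

/-- Now the truncation ends at the vertex `1` relative to `g`, and a step leads to `2` or, after
wrapping around, to `2 - numVert < 0`. -/
theorem leavesSide_negStep : LeavesSide S (-1) S.negStep := by
  intro g hg
  have h0 : (-1 : ℤ) + truncTurn (- -1) = 1 := by simp [truncTurn]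
  rw [h0]
  unfold negStep
  split_ifs with h
  · have hh : S.holed g.1 = false := h.1
    have h1 := n_lt_numVert hh
    rcases hg with hg | hg
    · simp [hh] at hg
    · change 1 + (1 - (S.numVert g.1 : ℤ)) ≠ 0 ∧ 1 + (1 - (S.numVert g.1 : ℤ)) ≠ 1
      omega
  · omega

/-- The turns of a rotated part of a curve which turns with `d` after entering a polygon through
the side `g`. -/
theorem exists_turns_of_moveEnd {w w' c : S.Curve} {P B : List ℤ} {d : ℤ}
    {step : S.Vertex → ℤ} (hstep : LeavesSide S d step)
    (hw : w.turns = joinTurns (P ++ d :: B) (revTurns (-truncTurn (-d) :: B)))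
    (hw' : MoveEnd step w w') (hc : Homotopic w' c) (hm : ∀ c', ¬ Move c c')
    {p : ℤ} {l : List ℤ} (hP : P = p :: l) (hp : p ≠ 0 ∧ p ≠ -1) (hl : ∀ z ∈ l, z ≠ 0)
    {g : S.Side} (hg : S.IsSide g.1 (g.2.1 + d))
    (hu : ∀ (u : S.Curve) (e : ℤ), u.start = w.start → u.turns = P ++ [e] →
      u.exits[l.length]?.map S.glue = some g) :
    c.start = w.start ∧ ∃ e, c.turns = P ++ [e] := by
  obtain ⟨u, hus, hut, -, huf⟩ := spursTo_joinTurns _ _ _ _ _ hw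
  obtain ⟨h, hh, rfl⟩ := Option.map_eq_some_iff.1 (hu u _ hus hut)
  have hf := (endFrom_eq _ _ u.valid hh (e := d - -truncTurn (-d)) (by rw [hut, hP]; simp)
    (by rw [hut, hP]; simp)).1
  rw [sub_neg_eq_add] at hf
  -- The step is read at the end of `w`, which is also the end of the spur-free curve `u`; there its
  -- coordinate relative to `g` is known.
  have hst := hstep _ hg
  rw [← hf, show S.endFrom _ _ _ = u.finish from rfl, huf] at hst
  rw [← sub_neg_eq_add d] at hst
  exact (start_turns_of_rotation hw hw'.1 hw'.2 hc hm hP hp hl hst).imp_right fun h => ⟨_, h⟩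

/-- Here `a` and `b` are the turns of the segments `c_m` and `c_{n+1}`, which the truncation
modifies, and `B`, `B'` are the turns between them, separated at the `i`-th crossing. -/
theorem exists_decomp (t : List ℤ) {m i n : ℕ} (hm : 1 ≤ m) (hi : m ≤ i) (hn : i ≤ n)
    (hl : n + 1 ≤ t.length) : ∃ A a B B' b D, t = A ++ a :: (B ++ (B' ++ b :: D)) ∧
      A.length + 1 = m ∧ B.length = i - m ∧ B'.length = n - i := by
  refine ⟨t.take (m - 1), t[m - 1], (t.drop m).take (i - m), (t.drop i).take (n - i), t[n],
    t.drop (n + 1), ?_, by simp; omega, by simp; omega, by simp; omega⟩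
  have h1 : t.drop i = (t.drop i).take (n - i) ++ t[n] :: t.drop (n + 1) := by
    conv_lhs => rw [← List.take_append_drop (n - i) (t.drop i)]
    rw [List.drop_drop, show i + (n - i) = n by omega,
      List.drop_eq_getElem_cons (show n < t.length by omega)]
  have h2 : t.drop m = (t.drop m).take (i - m) ++ t.drop i := by
    conv_lhs => rw [← List.take_append_drop (i - m) (t.drop m)]
    rw [List.drop_drop, show m + (i - m) = i by omega]
  conv_lhs => rw [← List.take_append_drop (m - 1) t]
  rw [List.drop_eq_getElem_cons (by omega), ← h1, ← h2, show m - 1 + 1 = m by omega]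

theorem IsTrunc.occurs {c c' : S.Perm} {m n : ℕ} (h : IsTrunc c.1 m n c'.1) :
    Occurs c'.string c.string fun q => m - 1 ≤ q ∧ q < n := by
  obtain ⟨hm, hmn, hn, f, g, a, b, -, -, -, -, ht, he, -⟩ := h
  refine (occurs_of_shift (a := m - 1) (m := n + 1 - m) ?_ ?_ (fun p hp => ?_)
    fun p hp => ?_).congr fun q _ => by omega
  · rw [ht]; simp; omega
  · omega
  · rw [he, List.getElem?_take_of_lt hp, List.getElem?_drop]
  · rw [ht, List.cons_append, List.getElem?_cons_succ, List.getElem?_append_left (by simp; omega),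
      List.getElem?_take_of_lt (by omega), List.getElem?_drop]
    congr 1; omega

/-- The last turn `e` is irrelevant to the string: `P` alone determines the crossings and the
letters. -/
theorem occurs_of_prefix {c c' : S.Perm} {P D : List ℤ} {e : ℤ} (hP : P ≠ []) (hD : D ≠ [])
    (hs : c'.1.start = c.1.start) (ht : c.1.turns = P ++ D) (ht' : c'.1.turns = P ++ [e]) :
    Occurs c'.string c.string fun q => q < P.length := by
  have hD' := List.length_pos_of_ne_nil hD
  have hP' := List.length_pos_of_ne_nil hP
  have hl : c.1.turns.length = P.length + D.length := by simp [ht]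
  have hl' : c'.1.turns.length = P.length + 1 := by simp [ht']
  have htt : ∀ p < P.length, c'.1.turns[p]? = c.1.turns[p]? := fun p hp => by
    rw [ht, ht', List.getElem?_append_left hp, List.getElem?_append_left hp]
  refine (occurs_of_shift (a := 0) hl' (by omega) (fun p hp => ?_) fun p hp => ?_).congr
    fun q _ => by omega
  · rw [zero_add]
    have h1 := List.getElem?_eq_getElem (show 0 < c.1.turns.length by omega)
    have h2 := htt 0 (by omega)
    rw [h1] at h2
    have h0 : c'.1.exits[0]? = c.1.exits[0]? := by
      rw [Curve.exits, Curve.exits, hs, exitsFrom_zero _ _ h1 (by omega),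
        exitsFrom_zero _ _ h2 (by omega)]
    have := exitsFrom_agree h0 (m := p) (by omega) (by omega) fun j hj => by
      rw [htt _ (by omega)]
    rwa [zero_add] at this
  · rw [zero_add, htt _ (by omega)]

theorem getElem?_append_revTurns {t A D : List ℤ} {e : ℤ} (ht : t = A ++ D) {p : ℕ}
    (hp : p < D.length) : (revTurns D ++ [e])[p]? = (revTurns t)[p]? := by
  rw [ht, revTurns_append, List.getElem?_append_left (by rwa [length_revTurns]),
    List.getElem?_append_left (by rwa [length_revTurns])]

/-- The crossing at position `n` follows the turn with index `n`, the last one of `A`; the reverse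
of `D` therefore meets exactly the crossings from `n` on. -/
theorem occurs_of_suffix {c c' : S.Perm} {A D : List ℤ} {e : ℤ} {n : ℕ} (hn : A.length = n + 1)
    (hs : c'.1.start = c.1.finish) (ht : c.1.turns = A ++ D)
    (ht' : c'.1.turns = revTurns D ++ [e]) : Occurs c'.string c.string fun q => n ≤ q := by
  have hl : c.1.turns.length = A.length + D.length := by simp [ht]
  have hl' : c'.1.turns.length = D.length + 1 := by simp [ht', length_revTurns]
  refine occurs_of_reverse (by omega) (fun p q hp hq => ?_) fun p q hp hq => ?_
  · rw [Curve.exits, hs]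
    exact c.1.exitsFrom_reverse hp (fun j _ => by
      rw [ht']; exact getElem?_append_revTurns ht (by omega)) hq
  · rw [ht', getElem?_append_revTurns ht (by omega), getElem?_revTurns (j' := q) (by omega)]

theorem IsPermissible.of_turns {c : S.Curve} (hc : c.IsPermissible) {d e : ℤ} {l : List ℤ}
    (h : c.turns = d :: l ++ [e]) :
    (d ≠ 0 ∧ d ≠ -1) ∧ (e ≠ 0 ∧ e ≠ 1) ∧ ∀ z ∈ l, z = 1 ∨ z = -1 := by
  have h1 := not_move_ends hc.minimal.not_move h
  have h2 := hc.middle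
  rw [h] at h2
  exact ⟨h1.1, h1.2, by simpa using h2⟩

theorem IsPermissible.prefix {c : S.Curve} (hc : c.IsPermissible) {p : ℤ} {l D : List ℤ}
    (hD : D ≠ []) (h : c.turns = p :: l ++ D) : (p ≠ 0 ∧ p ≠ -1) ∧ ∀ z ∈ l, z ≠ 0 := by
  obtain ⟨L, e, rfl⟩ := (List.eq_nil_or_concat' D).resolve_left hD
  have := IsPermissible.of_turns hc (d := p) (l := l ++ L) (e := e) (by rw [h]; simp)
  refine ⟨this.1, fun z hz => ?_⟩
  have := this.2.2 z (by simp [hz])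
  omega

theorem IsPermissible.suffix {c : S.Curve} (hc : c.IsPermissible) {e : ℤ} {A l : List ℤ}
    (hA : A ≠ []) (h : c.turns = A ++ (l ++ [e])) :
    (-e ≠ 0 ∧ -e ≠ -1) ∧ ∀ z ∈ revTurns l, z ≠ 0 := by
  obtain ⟨d, L, rfl⟩ := List.exists_cons_of_ne_nil hA
  have := IsPermissible.of_turns hc (d := d) (l := L ++ l) (e := e) (by rw [h]; simp)
  refine ⟨by omega, fun z hz => ?_⟩
  obtain ⟨z', hz', rfl⟩ : ∃ z' ∈ l, -z' = z := by simpa [revTurns] using hz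
  have := this.2.2 z' (by simp [hz'])
  omega

/-- The rotated first part carries the string before the truncation. -/
theorem IsRotFirst.occurs {d : ℤ} {step : S.Vertex → ℤ} (hstep : LeavesSide S d step)
    {c c₂ x : S.Perm} {m i n : ℕ} (hT : TurnsAt d c.1 m i n) (h₂ : IsTrunc c.1 m n c₂.1)
    (hx : IsRotFirst step c.1 i c₂.1 (i + 1 - m) x.1) :
    Occurs x.string c.string fun q => q + 1 < m := by
  obtain ⟨hm, hmi, hin, hn, hleft, -⟩ := hT
  obtain ⟨-, -, -, f, g, a', -, ha', -, hf, -, ht₂, -, -⟩ := h₂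
  obtain ⟨w, w', hws, hw, hww', hc⟩ := hx
  obtain ⟨A, a, B, B', b, D, ht, hA, hB, hB'⟩ := exists_decomp c.1.turns hm hmi hin hn
  have e1 : c.1.turns.take i = A ++ a :: B := by
    rw [ht, show A ++ a :: (B ++ (B' ++ b :: D)) = (A ++ a :: B) ++ (B' ++ b :: D) by simp]
    exact List.take_left' (by simp; omega)
  have e2 : (c.1.turns.drop m).take (n - m) = B ++ B' := by
    rw [ht, show A ++ a :: (B ++ (B' ++ b :: D)) = (A ++ [a]) ++ ((B ++ B') ++ b :: D) by simp,
      List.drop_left' (by simpa using hA)]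
    exact List.take_left' (by simp; omega)
  have e3 : c₂.1.turns.take (i + 1 - m) = f :: B := by
    rw [ht₂, e2, show f :: (B ++ B') ++ [g] = (f :: B) ++ (B' ++ [g]) by simp]
    exact List.take_left' (by simp; omega)
  have ha : a' = a := by
    rw [ht, List.getElem?_append_right (by omega), show m - 1 - A.length = 0 by omega] at ha'
    simpa using ha'.symm
  subst ha
  rw [e1, e3] at hw
  -- If `A` is empty, then `m = 1`: nothing of `c` precedes the truncation and the rotated part is
  -- trivial.
  cases A with
  | nil =>
    rw [string_eq_none (length_of_trivial_rotation hw hww'.2 hc x.2.minimal)]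
    refine Occurs.none _ fun q _ hq => ?_
    simp at hA
    omega
  | cons p l =>
    have hm1 : m ≠ 1 := by simp at hA; omega
    have had : a' = d := by
      have := hleft (m - 1) (by omega) (by omega) (by omega)
      rw [ha'] at this
      exact Option.some.inj this
    subst had
    rw [if_neg hm1] at hf
    subst hf
    have hp := IsPermissible.prefix c.2 (p := p) (l := l) (by simp) ht
    simp only [List.length_cons] at hA
    have hlt : l.length < c.1.exits.length := by rw [length_exits]; omega
    have hE := List.getElem?_eq_getElem hlt
    have hg := isSide_of_exitsFrom _ _ c.1.valid hE
      (show c.1.turns[l.length + 1]? = some a' by rw [ht]; simp) (by omega)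
    obtain ⟨hs, e, he⟩ := exists_turns_of_moveEnd hstep hw hww' hc x.2.minimal.not_move rfl hp.1
      hp.2 hg fun u e hus hut => by
        have h1 : c.1.turns[0]? = some p := by rw [ht]; simp
        have h2 : u.turns[0]? = some p := by rw [hut]; simp
        have hul : u.turns.length = l.length + 2 := by rw [hut]; simp
        have h0 : u.exits[0]? = c.1.exits[0]? := by
          rw [Curve.exits, Curve.exits, hus, hws, exitsFrom_zero _ _ h1 (by omega),
            exitsFrom_zero _ _ h2 (by omega)]
        have := exitsFrom_agree h0 (m := l.length) (by omega) (by omega) fun j hj => by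
          rw [ht, hut, List.getElem?_append_left (by simp; omega),
            List.getElem?_append_left (by simp; omega)]
        rw [zero_add] at this
        rw [show u.exits[l.length]? = _ from this, show S.exitsFrom _ _ _ = c.1.exits from rfl, hE]
        rfl
    exact (occurs_of_prefix (by simp) (by simp) (hs.trans hws) ht he).congr fun q _ => by
      simp; omega

/-- The rotated second part carries the string after the truncation. -/
theorem IsRotSecond.occurs {d : ℤ} {step : S.Vertex → ℤ} (hstep : LeavesSide S d step)
    {c c₂ x : S.Perm} {m i n : ℕ} (hT : TurnsAt d c.1 m i n) (h₂ : IsTrunc c.1 m n c₂.1)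
    (hx : IsRotSecond step c.1 i c₂.1 (i + 1 - m) x.1) :
    Occurs x.string c.string fun q => n ≤ q := by
  obtain ⟨hm, hmi, hin, hn, -, hright⟩ := hT
  obtain ⟨-, -, -, f, g, -, b', -, hb', -, hg, ht₂, -, -⟩ := h₂
  obtain ⟨w, w', hws, hw, hww', hc⟩ := hx
  obtain ⟨A, a, B, B', b, D, ht, hA, hB, hB'⟩ := exists_decomp c.1.turns hm hmi hin hn
  have ht' : c.1.turns = (A ++ a :: (B ++ (B' ++ [b]))) ++ D := by rw [ht]; simp
  have hlen : (A ++ a :: (B ++ (B' ++ [b]))).length = n + 1 := by simp; omega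
  have e1 : c.1.turns.drop i = B' ++ b :: D := by
    rw [ht, show A ++ a :: (B ++ (B' ++ b :: D)) = (A ++ a :: B) ++ (B' ++ b :: D) by simp]
    exact List.drop_left' (by simp; omega)
  have e2 : (c.1.turns.drop m).take (n - m) = B ++ B' := by
    rw [ht, show A ++ a :: (B ++ (B' ++ b :: D)) = (A ++ [a]) ++ ((B ++ B') ++ b :: D) by simp,
      List.drop_left' (by simpa using hA)]
    exact List.take_left' (by simp; omega)
  have e3 : c₂.1.turns.drop (i + 1 - m) = revTurns (-g :: revTurns B') := by
    rw [ht₂, e2, show f :: (B ++ B') ++ [g] = (f :: B) ++ (B' ++ [g]) by simp,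
      List.drop_left' (by simp; omega), revTurns_cons, revTurns_revTurns, neg_neg]
  have hb : c.1.turns[n]? = some b := by
    rw [ht', List.getElem?_append_left (by omega),
      show A ++ a :: (B ++ (B' ++ [b])) = (A ++ a :: (B ++ B')) ++ [b] by simp,
      List.getElem?_append_right (by simp; omega)]
    have : n - (A ++ a :: (B ++ B')).length = 0 := by simp; omega
    rw [this]; rfl
  obtain rfl : b = b' := Option.some.inj (hb.symm.trans hb')
  -- Seen from the end of `c`, the second part has the form of a first part: reversal makes the turn
  -- `-d` at `γ_n` into `d`.
  rw [e1, e3, revTurns_append, revTurns_cons, List.append_assoc, List.singleton_append] at hw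
  have hlD : c.1.turns.length = n + 1 + D.length := by rw [ht', List.length_append, hlen]
  rcases List.eq_nil_or_concat' D with rfl | ⟨l, e', rfl⟩
  · rw [string_eq_none (length_of_trivial_rotation
      (show w.turns = joinTurns (-b :: revTurns B') _ from hw) hww'.2 hc x.2.minimal)]
    refine Occurs.none _ fun q hq hq' => ?_
    rw [size_string] at hq
    simp at hlD
    omega
  · simp only [List.length_append, List.length_cons, List.length_nil] at hlD
    have hbd : b = -d := by
      have := hright n hin le_rfl (by omega)
      rw [hb] at this
      exact Option.some.inj this
    subst hbd
    rw [if_neg (by omega)] at hg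
    subst hg
    rw [neg_neg] at hw
    have hp := IsPermissible.suffix c.2 (by simp) ht'
    have hlt : n < c.1.exits.length := by rw [length_exits]; omega
    have hE := List.getElem?_eq_getElem hlt
    -- A crossing before the corner exists because `1 ≤ m ≤ n`.
    obtain ⟨n, rfl⟩ : ∃ n', n = n' + 1 := ⟨n - 1, by omega⟩
    have hg := isSide_reverse hE hb
    rw [neg_neg] at hg
    have hrev : revTurns (l ++ [e']) = -e' :: revTurns l := by
      rw [revTurns_append]; simp [revTurns]
    obtain ⟨hs, e, he⟩ := exists_turns_of_moveEnd hstep hw hww' hc x.2.minimal.not_move hrev hp.1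
      hp.2 hg fun u e hus hut => by
        have hul : u.turns.length = l.length + 2 := by rw [hut]; simp [length_revTurns]
        rw [length_revTurns, Curve.exits, hus, hws, c.1.exitsFrom_reverse (q := n + 1) (by omega)
          (fun j hj => by
            rw [hut]; exact getElem?_append_revTurns ht' (by simp; omega)) (by omega), hE]
        simp [S.glue_glue]
    exact occurs_of_suffix hlen (hs.trans hws) ht' he

theorem endFrom_fst (Δ : S.Poly) (i : ℤ) (l : List ℤ) (e e' : ℤ) :
    (S.endFrom Δ i (l ++ [e])).1 = (S.endFrom Δ i (l ++ [e'])).1 := by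
  induction l generalizing Δ i with
  | nil => rfl
  | cons d l ih =>
    rw [List.cons_append, List.cons_append, endFrom_cons _ _ _ (by simp),
      endFrom_cons _ _ _ (by simp)]
    exact ih _ _

theorem finish_fst {w w' : S.Curve} {s : ℤ} (hs : w'.start = w.start)
    (hw : w'.turns = joinTurns w.turns [s]) : w'.finish.1 = w.finish.1 := by
  obtain ⟨L, u, hL⟩ := (List.eq_nil_or_concat' w.turns).resolve_left w.turns_ne_nil
  rw [hL, joinTurns_append_singleton] at hw
  rw [Curve.finish, Curve.finish, hs, hw, hL]
  exact endFrom_fst _ _ _ _ _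

/-- Only the total step matters. In an annulus every positive step is `-1`, so the total is
negative; in a disc it may wrap around and have any sign. -/
theorem exists_of_transGen_moveEnd {w w' : S.Curve}
    (h : Relation.TransGen (MoveEnd S.posStep) w w') : w'.start = w.start ∧
      ∃ s, w'.turns = joinTurns w.turns [s] ∧ (S.holed w.finish.1 = true → s < 0) := by
  have hpos : ∀ v : S.Vertex, S.holed v.1 = true → S.posStep v < 0 := fun v hv => by
    simp [posStep, hv]
  induction h with
  | single h => exact ⟨h.1, _, h.2, hpos _⟩
  | @tail w' w'' _ h ih =>
    obtain ⟨h1, s, h2, h3⟩ := ih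
    refine ⟨h.1.trans h1, s + S.posStep w'.finish, by rw [h.2, h2, joinTurns_joinTurns],
      fun hh => ?_⟩
    have h4 := h3 hh
    have h5 := hpos w'.finish (by rw [finish_fst h1 h2]; exact hh)
    omega

/-- The rotated curve of type 1 carries the string after the truncation. -/
theorem IsProtOne.occurs {c c₂ c₃ : S.Perm} {i : ℕ} (hi : 1 ≤ i) (hl : i + 2 ≤ c.1.turns.length)
    (hti : c.1.turns[i]? = some (-1)) (h : IsProtOne c.1 i c₂.1 c₃.1) :
    Occurs c₃.string c.string fun q => i ≤ q := by
  obtain ⟨⟨-, -, -, f, g, a', b', ha', hb', hf, hg, ht₂, -, -⟩, w, w', hws, hw, htr, hc, hfin, h,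
    hh, hlast⟩ := h
  obtain ⟨A, a, B, B', b, D, ht, hA, hB, hB'⟩ :=
    exists_decomp c.1.turns le_rfl hi le_rfl (by omega : i + 1 ≤ _)
  obtain rfl : A = [] := List.length_eq_zero_iff.1 (by omega)
  obtain rfl : B' = [] := List.length_eq_zero_iff.1 (by omega)
  simp only [List.nil_append] at ht
  have ht' : c.1.turns = (a :: (B ++ [b])) ++ D := by rw [ht]; simp
  have hb : b = -1 := by
    rw [ht', List.getElem?_append_left (by simp; omega),
      show a :: (B ++ [b]) = (a :: B) ++ [b] by simp,
      List.getElem?_append_right (by simp; omega)] at hti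
    have : i - (a :: B).length = 0 := by simp; omega
    rw [this] at hti
    exact Option.some.inj hti
  subst hb
  have ha : a' = a := by rw [ht] at ha'; simpa using ha'.symm
  rw [hti] at hb'
  obtain rfl := Option.some.inj hb'
  rw [if_pos rfl, ha] at hf
  rw [if_neg (by omega)] at hg
  have hlD : c.1.turns.length = i + 1 + D.length := by rw [ht']; simp; omega
  have e2 : (c.1.turns.drop 1).take (i - 1) = B := by
    rw [ht]; exact List.take_left' hB
  -- The truncation ends with the turn `-1`, as does `c` at this corner before going on; in the
  -- cancellation `x = y = 1`, so the last turn of the rotated curve is just the total step `s`.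
  have hw2 : c₂.1.turns = revTurns (1 :: revTurns (a :: B)) := by
    rw [ht₂, e2, revTurns_cons, revTurns_revTurns, hf, hg]
    simp [truncTurn]
  obtain ⟨l, e', hD⟩ := (List.eq_nil_or_concat' D).resolve_left (by rintro rfl; simp at hlD; omega)
  have hlD' : D.length = l.length + 1 := by rw [hD]; simp
  have hw1 : revTurns c.1.turns = revTurns D ++ 1 :: revTurns (a :: B) := by
    rw [ht, show a :: (B ++ -1 :: D) = (a :: B) ++ ([-1] ++ D) by simp, revTurns_append,
      revTurns_append]
    simp [revTurns]
  rw [hw1, hw2] at hw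
  obtain ⟨hs', s, hw', hneg⟩ := exists_of_transGen_moveEnd htr
  have hrev : revTurns D = -e' :: revTurns l := by
    rw [hD, revTurns_append]; simp [revTurns]
  have hp := IsPermissible.suffix c.2 (by simp) (hD ▸ ht')
  have huE : ∀ (u : S.Curve) (e : ℤ), u.start = c.1.finish → u.turns = revTurns D ++ [e] →
      u.finish = S.vertexAt h.1 (h.2.1 + e) ∧ S.IsVertex h.1 (h.2.1 + e) := by
    intro u e hus hut
    have hul : u.turns.length = l.length + 2 := by rw [hut]; simp [length_revTurns, hlD']
    have hue : u.exits[l.length]? = some (S.glue h) := by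
      rw [Curve.exits, hus, c.1.exitsFrom_reverse (q := i) (by omega)
        (fun j hj => by
          rw [hut]; exact getElem?_append_revTurns ht' (by omega)) (by omega), hh]
      rfl
    have := endFrom_eq _ _ u.valid hue (e := e) (by rw [hut]; simp [length_revTurns, hlD']) hul
    rwa [S.glue_glue] at this
  -- In an annulus `s` is negative. In a disc, coordinates of vertices are exact, so the common
  -- endpoint and common last side force `s` to be the last turn of `c₃`, which is neither `0` nor
  -- `1` because `c₃` is minimal.
  have hs01 : s ≠ 0 ∧ s ≠ 1 := by
    by_cases hho : S.holed h.1 = true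
    · obtain ⟨u, hus, hut, -, huf⟩ := spursTo_joinTurns _ _ _ _ _ hw
      have h1 := (huE u _ (hus.trans hws) hut).1
      rw [huf] at h1
      have := hneg (by rw [h1]; exact hho)
      omega
    · have hho' : S.holed h.1 = false := Bool.eq_false_iff.2 hho
      have hw'' := hw'
      rw [hw, joinTurns_revTurns_cons _ _ (by simp)] at hw''
      obtain ⟨u, hus, hut, -, huf⟩ := spursTo_joinTurns _ _ _ _ _ hw''
      rw [show (1 : ℤ) - (1 - s) = s by ring] at hut
      have h1 := huE u _ (hus.trans (hs'.trans hws)) hut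
      rw [List.getLast?_eq_getElem?, length_exits] at hlast
      have hlt := (List.getElem?_eq_some_iff.1 hlast).1
      rw [length_exits] at hlt
      obtain ⟨L, f', hL⟩ := (List.eq_nil_or_concat' c₃.1.turns).resolve_left c₃.1.turns_ne_nil
      have hLl : c₃.1.turns.length = L.length + 1 := by rw [hL]; simp
      obtain ⟨d, L, rfl⟩ := List.exists_cons_of_ne_nil (l := L) (by
        rintro rfl; simp at hLl; omega)
      have hf01 := (IsPermissible.of_turns c₃.2 hL).2.1
      have hLl' : c₃.1.turns.length = L.length + 2 := by rw [hL]; simp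
      have h2 := endFrom_eq _ _ c₃.1.valid (j := L.length) (h := S.glue h) (e := f')
        (by rw [← hlast, hLl']; rfl) (by rw [hL]; simp) hLl'
      rw [S.glue_glue] at h2
      have h3 : S.vertexAt h.1 (h.2.1 + f') = S.vertexAt h.1 (h.2.1 + s) := by
        rw [← h2.1, ← h1.1, huf, ← hfin]; rfl
      have h4 := coe_vertexAt_of_not_holed hho' h1.2
      rw [← h3, coe_vertexAt_of_not_holed hho' h2.2] at h4
      obtain rfl : f' = s := by omega
      exact hf01
  obtain ⟨hs, he⟩ := start_turns_of_rotation hw hs' hw' hc c₃.2.minimal.not_move hrev hp.1 hp.2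
    (by simpa using hs01)
  exact occurs_of_suffix (by simp; omega) (hs.trans hws) ht' he

end Rotations

end MarkedRibbonSurface

namespace MarkedRibbonSurface

/-! ### The three exact sequences -/

section Sequences

open BoundQuiver

variable {V E : Type*} {Q : BoundQuiver V E} {S : MarkedRibbonSurface}
  (φ : S.boundQuiver.Iso Q) (k : Type*) [CommRing k]

/-- An arrow of the string of `c` leads from a crossing to a neighbouring one, in the direction
given by the turn. -/
theorem turn_of_leads {c : S.Perm} {α : E} {p q : ℕ}
    (h : Leads α (c.string.map φ.mapStr) p q) :
    q = p + 1 ∧ p + 2 < c.1.turns.length ∧ c.1.turns[p + 1]? = some 1 ∨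
      p = q + 1 ∧ q + 2 < c.1.turns.length ∧ c.1.turns[q + 1]? = some (-1) := by
  rw [leads_map, leads_string] at h
  exact h.imp (fun h => ⟨h.1, h.2.1, h.2.2.1⟩) fun h => ⟨h.1, h.2.1, h.2.2.1⟩

theorem CaseI.hasShortExact [Fintype V] {c c' c'' : S.Perm} (h : CaseI c c' c'') :
    HasShortExact (Q.Algebra k)ᵐᵒᵖ (c'.M φ k) (c.M φ k) (c''.M φ k) := by
  obtain ⟨i, hi, hl, ht, c₂, c₃, h₂, h', h₃, h''⟩ := h
  refine hasShortExact_of_occurs k (P := fun q => q < i)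
    (((h'.occurs.trans h₂.occurs).map φ).congr fun q _ => by omega)
    (((h''.occurs.trans (h₃.occurs hi hl ht)).map φ).congr fun q _ => by omega)
    fun α p q hα hp => ?_
  rcases turn_of_leads φ hα with ⟨rfl, -, h1⟩ | ⟨rfl, -, -⟩
  -- An arrow leaving the positions below `i` would have to be the letter of the turn with index
  -- `i`, but that turn is `-1`.
  · by_contra hq
    obtain rfl : i = p + 1 := by omega
    rw [ht] at h1
    simp at h1
  · omega

theorem CaseTwoSided.occurs {d : ℤ} {step : S.Vertex → ℤ} (hstep : LeavesSide S d step)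
    {c c₁ x y : S.Perm} (h : CaseTwoSided d step c c₁ x y) :
    ∃ m i n, TurnsAt d c.1 m i n ∧
      Occurs (c₁.string.map φ.mapStr) (c.string.map φ.mapStr) (fun q => m ≤ q + 1 ∧ q < n) ∧
      Occurs (x.string.map φ.mapStr) (c.string.map φ.mapStr) (fun q => q + 1 < m) ∧
      Occurs (y.string.map φ.mapStr) (c.string.map φ.mapStr) (fun q => n ≤ q) := by
  obtain ⟨m, i, n, hT, c₂, h₂, h₁, ⟨x', hx, hx'⟩, y', hy, hy'⟩ := h
  exact ⟨m, i, n, hT, ((h₁.occurs.trans h₂.occurs).map φ).congr fun q _ => by omega,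
    (hx'.occurs.trans (hx.occurs hstep hT h₂)).map φ,
    (hy'.occurs.trans (hy.occurs hstep hT h₂)).map φ⟩

/-- At the ends of the truncation, all arrows point inwards for `d = 1`, outwards for `d = -1`. -/
theorem TurnsAt.ends {d : ℤ} {c : S.Curve} {m i n : ℕ} (h : TurnsAt d c m i n) :
    (∀ j, m = j + 1 → 1 ≤ j → c.turns[j]? = some d) ∧
      (n + 1 < c.turns.length → c.turns[n]? = some (-d)) :=
  ⟨fun j hj hj' => h.2.2.2.2.1 j (by omega) hj' (by have := h.2.1; omega),
    fun hn => h.2.2.2.2.2 n h.2.2.1 le_rfl hn⟩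

theorem CaseII.hasShortExact [Fintype V] {c c' x y : S.Perm} (h : CaseII c c' x y) :
    HasShortExact (Q.Algebra k)ᵐᵒᵖ (c'.M φ k) (c.M φ k) (x.M φ k × y.M φ k) := by
  obtain ⟨m, i, n, hT, h₁, hx, hy⟩ := CaseTwoSided.occurs φ leavesSide_posStep h
  obtain ⟨hleft, hright⟩ := hT.ends
  have hmn : m ≤ n := hT.2.1.trans hT.2.2.1
  -- Arrows join neighbours, and at the two boundaries of the interval `m - 1 ≤ q < n` none points
  -- outwards. All closure conditions follow by arithmetic.
  have key : ∀ α p q, Leads α (c.string.map φ.mapStr) p q →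
      (q = p + 1 ∨ p = q + 1) ∧ ¬ (p = q + 1 ∧ m = q + 2) ∧ ¬ (q = p + 1 ∧ n = p + 1) := by
    intro α p q hα
    rcases turn_of_leads φ hα with ⟨rfl, hl, h1⟩ | ⟨rfl, hl, h1⟩
    · refine ⟨by omega, by omega, fun h => ?_⟩
      rw [← h.2, hright (by omega)] at h1
      simp at h1
    · refine ⟨by omega, fun h => ?_, by omega⟩
      rw [hleft (q + 1) (by omega) (by omega)] at h1
      simp at h1
  have hm := hT.1
  refine hasShortExact_prod_right k h₁ hx hy ?_ ?_ ?_ (fun q => by omega) (fun q => by omega) <;>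
  · intro α p q hα hp
    have h1 := key α p q hα
    omega

theorem CaseIII.hasShortExact [Fintype V] {c c'' x y : S.Perm} (h : CaseIII c c'' x y) :
    HasShortExact (Q.Algebra k)ᵐᵒᵖ (x.M φ k × y.M φ k) (c.M φ k) (c''.M φ k) := by
  obtain ⟨m, i, n, hT, h₁, hx, hy⟩ := CaseTwoSided.occurs φ leavesSide_negStep h
  obtain ⟨hleft, hright⟩ := hT.ends
  have hmn : m ≤ n := hT.2.1.trans hT.2.2.1
  -- Dually, no arrow enters the interval, so it carries a quotient and both outer pieces are
  -- submodules.
  have key : ∀ α p q, Leads α (c.string.map φ.mapStr) p q →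
      (q = p + 1 ∨ p = q + 1) ∧ ¬ (q = p + 1 ∧ m = p + 2) ∧ ¬ (p = q + 1 ∧ n = q + 1) := by
    intro α p q hα
    rcases turn_of_leads φ hα with ⟨rfl, hl, h1⟩ | ⟨rfl, hl, h1⟩
    · refine ⟨by omega, fun h => ?_, by omega⟩
      rw [hleft (p + 1) (by omega) (by omega)] at h1
      simp at h1
    · refine ⟨by omega, by omega, fun h => ?_⟩
      rw [← h.2, hright (by omega)] at h1
      simp at h1
  have hm := hT.1
  refine hasShortExact_prod_left k h₁ hx hy ?_ ?_ ?_ (fun q => by omega) (fun q => by omega) <;>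
  · intro α p q hα hp
    have h1 := key α p q hα
    omega

end Sequences

end MarkedRibbonSurface

theorem mainTheorem2 {V E : Type*} [Fintype V] [Finite E] (Q : BoundQuiver V E)
    (_hQ : Q.IsGentle) (S : MarkedRibbonSurface) (φ : S.boundQuiver.Iso Q)
    (k : Type*) [Field k] :
    (∀ c c' c'' : S.Perm, MarkedRibbonSurface.CaseI c c' c'' →
      HasShortExact (Q.Algebra k)ᵐᵒᵖ (c'.M φ k) (c.M φ k) (c''.M φ k)) ∧
    (∀ c c' c₁'' c₂'' : S.Perm, MarkedRibbonSurface.CaseII c c' c₁'' c₂'' →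
      HasShortExact (Q.Algebra k)ᵐᵒᵖ (c'.M φ k) (c.M φ k) (c₁''.M φ k × c₂''.M φ k)) ∧
    (∀ c c₁' c₂' c'' : S.Perm, MarkedRibbonSurface.CaseIII c c'' c₁' c₂' →
      HasShortExact (Q.Algebra k)ᵐᵒᵖ (c₁'.M φ k × c₂'.M φ k) (c.M φ k) (c''.M φ k)) :=
  ⟨fun _ _ _ h => h.hasShortExact φ k, fun _ _ _ _ h => h.hasShortExact φ k,
    fun _ _ _ _ h => h.hasShortExact φ k⟩
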